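/- Let $q$ be a prime power. If $q$ is odd, fix a non-square $c\in\mathbb F_q$; if $q$ is even, fix $c\in\mathbb F_q$ such that $X^2+X+c$ is irreducible over $\mathbb F_q$. Let $\mathbb F_q[Z]$ be the quadratic extension of $\mathbb F_q$ given by $Z^2=c$ ($q$ odd), respectively $Z^2+Z=c$ ($q$ even), with norm $N:\mathbb F_q[Z]\to\mathbb F_q$; we identify it with $\mathbb F_{q^2}$. For a finite set $S\supseteq\{0,\infty\}$ of $\mathbb F_q$-rational points of $\mathbb P^1$ let $\mathfrak o_{K,S}\subseteq K=\mathbb F_q(t)$ be the ring of rational functions that are regular outside $S$, and let $$\Lambda_S=\begin{cases}\big(\mathfrak o_{K,S}\{Z,F\}/(Z^2=c,\ F^2=t,\ FZ=-ZF)\big)^\times/\mathfrak o_{K,S}^\times & (q\text{ odd}),\\ \big(\mathfrak o_{K,S}\{Z,F\}/(Z^2+Z=c,\ F^2=t,\ FZ=(Z+1)F)\big)^\times/\mathfrak o_{K,S}^\times & (q\text{ even}).\end{cases}$$ Write $[x]$ for the class of a unit $x$, and let $\Gamma_S\subseteq\Lambda_S$ be the subgroup generated by all $[1+\alpha F]$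 with $\alpha\in\mathbb F_q[Z]$, $N(\alpha)\neq0$ and $N(\alpha)^{-1}\in S$. Let $\delta$ be a generator of the cyclic group $\mathbb F_q[Z]^\times$. For $i,j\in\mathbb Z/(q^2-1)$ with $i\not\equiv j\pmod{q-1}$ one has $1+\delta^{j-i}\ne0$; let $x_{i,j}\in\mathbb Z/(q^2-1)$ be the unique element with $\delta^{x_{i,j}}=1+\delta^{j-i}$, put $y_{i,j}=x_{i,j}+i-j$, and $$k(i,j)=j-y_{i,j}(q-1),\qquad l(i,j)=i-x_{i,j}(q-1).$$ Let $M\subseteq\mathbb Z/(q^2-1)$ be a union of cosets of $(q-1)\mathbb Z/(q^2-1)$. Let $\Gamma_{M,\delta}$ be the group with generators $a_i$ ($i\in M$) and relations * $a_{i+(q^2-1)/2}\,a_i=1$ for all $i\in M$ if $q$ is odd, respectively $a_i^2=1$ for all $i\in M$ if $q$ is even, * $a_ia_j=a_{k(i,j)}a_{l(i,j)}$ for all $i,j\in M$ with $i\not\equiv j\pmod{q-1}$. Let $\Lambda_{M,\delta}$ be the group with generators $d$, $s$, $a_i$ ($i\in M$), with the relations just listed and in addition $$d^{q+1}=s^2=(sd)^2=1,\qquad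 s a_i s=a_{qi},\quad d a_i d^{-1}=a_{i+1-q}\quad(i\in M).$$ Finally let $$S=\{0,\infty\}\cup\{\delta^{-i(q+1)}\ ;\ i\in M\}.$$ Then the assignment $d\mapsto[\delta]$, $s\mapsto[F]$, $a_i\mapsto[1+\delta^iF]$ defines an isomorphism $\Lambda_{M,\delta}\xrightarrow{\sim}\Lambda_S$. It restricts to an isomorphism $\Gamma_{M,\delta}\xrightarrow{\sim}\Gamma_S$; that is, its composite with the natural homomorphism $\Gamma_{M,\delta}\to\Lambda_{M,\delta}$, $a_i\mapsto a_i$, is an isomorphism onto the subgroup $\Gamma_S$. -/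

import Mathlib

open Polynomial

namespace QuatLattice

/-! ### The arithmetic side: the quaternion order over the ring of `S`-integers -/

section Arithmetic

variable (𝔽 : Type*) [Field 𝔽]

/-- The conditions on the constants `b`, `c` that fix the quaternion algebra over `𝔽(t)`, where
`q = #𝔽`: for odd `q` one has `Z² = c` with `c` a non-square (and `b = 0`), for even `q` one has
`Z² + Z = c`, that is `Z² = c + Z` (so `b = 1`), with `X² + X + c` irreducible. -/
def IsParam {𝔽 : Type*} [Field 𝔽] (q : ℕ) (b c : 𝔽) : Prop :=
  (Odd q ∧ b = 0 ∧ ¬ IsSquare c) ∨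
    (Even q ∧ b = 1 ∧ Irreducible (X ^ 2 + X + C c : 𝔽[X]))

/-- The quadratic extension `𝔽[Z] = 𝔽 ⊕ 𝔽 Z` of `𝔽`, where `Z² = c + b Z`. -/
abbrev FZ {𝔽 : Type*} [Field 𝔽] (b c : 𝔽) : Type _ := QuadraticAlgebra 𝔽 c b

variable {𝔽}

/-- The finite places of the projective line over `𝔽` that lie in `S = {0, ∞} ∪ S₀`: the place
`t = 0` and the places `t = τ` with `τ ∈ S₀`. -/
def finitePlaces (S₀ : Set 𝔽ˣ) : Set (IsDedekindDomain.HeightOneSpectrum 𝔽[X]) :=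
  {v | v.asIdeal = Ideal.span {(X : 𝔽[X])} ∨
    ∃ τ ∈ S₀, v.asIdeal = Ideal.span {X - C (τ : 𝔽)}}

/-- The ring of `S`-integers of `𝔽(t)` for `S = {0, ∞} ∪ S₀`: the rational functions that are
regular at all places outside `S`. As `∞ ∈ S`, there is no condition at infinity. -/
noncomputable abbrev SInt (S₀ : Set 𝔽ˣ) : Subalgebra 𝔽[X] (RatFunc 𝔽) :=
  (finitePlaces S₀).integer (RatFunc 𝔽)

/-- The embedding of the constants `𝔽` into the `S`-integers. -/
noncomputable def const (S₀ : Set 𝔽ˣ) : 𝔽 →+* SInt S₀ :=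
  (algebraMap 𝔽[X] (SInt S₀)).comp C

/-- The order `𝔬{Z, F} / (Z² = c + b Z, F² = t, F Z = (b - Z) F)` over the ring `𝔬` of
`S`-integers. It is free over `𝔬` with basis `1, Z, F, Z F`. For `b = 0` the last relation says
`F Z = - Z F`, and for `b = 1` in characteristic two it says `F Z = (Z + 1) F`. -/
abbrev QOrder (b c : 𝔽) (S₀ : Set 𝔽ˣ) : Type _ :=
  QuaternionAlgebra (SInt S₀) (const S₀ c) (const S₀ b) (algebraMap 𝔽[X] (SInt S₀) X)

/-- The inclusion `𝔽[Z] → 𝔬 ⊕ 𝔬 Z` into the order. -/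
noncomputable def emb {b c : 𝔽} (S₀ : Set 𝔽ˣ) (α : FZ b c) : QOrder b c S₀ :=
  ⟨const S₀ α.re, const S₀ α.im, 0, 0⟩

/-- The element `F` of the order. -/
noncomputable def elemF (b c : 𝔽) (S₀ : Set 𝔽ˣ) : QOrder b c S₀ := ⟨0, 0, 1, 0⟩

/-- The image of `𝔬ˣ` in the unit group of the order. -/
noncomputable def scalars (b c : 𝔽) (S₀ : Set 𝔽ˣ) : Subgroup (QOrder b c S₀)ˣ :=
  (Units.map (algebraMap (SInt S₀) (QOrder b c S₀)).toMonoidHom).range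

instance (b c : 𝔽) (S₀ : Set 𝔽ˣ) : (scalars b c S₀).Normal where
  conj_mem := by
    rintro _ ⟨r, rfl⟩ g
    have h : g * Units.map (algebraMap (SInt S₀) (QOrder b c S₀)).toMonoidHom r =
        Units.map (algebraMap (SInt S₀) (QOrder b c S₀)).toMonoidHom r * g := by
      ext1
      exact (Algebra.commutes _ _).symm
    rw [h, mul_inv_cancel_right]
    exact ⟨r, rfl⟩

/-- The group `Λ_S`, for `S = {0, ∞} ∪ S₀`: the units of the order modulo `𝔬ˣ`. -/
abbrev Lambda (b c : 𝔽) (S₀ : Set 𝔽ˣ) : Type _ := (QOrder b c S₀)ˣ ⧸ scalars b c S₀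

/-- `IsClass g x` says that `x` is a unit of the order and that `g = [x]` is its class. -/
def IsClass {b c : 𝔽} {S₀ : Set 𝔽ˣ} (g : Lambda b c S₀) (x : QOrder b c S₀) : Prop :=
  ∃ u : (QOrder b c S₀)ˣ, (u : QOrder b c S₀) = x ∧ QuotientGroup.mk u = g

/-- The subgroup `Γ_S` of `Λ_S` generated by all `[1 + α F]`, where `α ∈ 𝔽[Z]` has norm `τ⁻¹`
for some `τ ∈ S₀`. -/
noncomputable def Gamma (b c : 𝔽) (S₀ : Set 𝔽ˣ) : Subgroup (Lambda b c S₀) :=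
  Subgroup.closure {g | ∃ α : FZ b c,
    (∃ τ ∈ S₀, QuadraticAlgebra.norm α = ((τ⁻¹ : 𝔽ˣ) : 𝔽)) ∧
      IsClass g (1 + emb S₀ α * elemF b c S₀)}

end Arithmetic

/-! ### The combinatorial side: the finitely presented groups -/

section Presentation

/-- The subgroup `(q - 1)ℤ / (q² - 1)` of `ℤ / (q² - 1)`. -/
def cosetGroup (q : ℕ) : AddSubgroup (ZMod (q ^ 2 - 1)) :=
  AddSubgroup.zmultiples ((q : ZMod (q ^ 2 - 1)) - 1)

variable {E : Type*} [CommRing E] {q : ℕ}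

/-- The power `δ ^ i` for `i ∈ ℤ / (q² - 1)`, where `δ ^ (q² - 1) = 1`. -/
def dpow (δ : Eˣ) (i : ZMod (q ^ 2 - 1)) : Eˣ := δ ^ i.val

open Classical in
/-- The discrete logarithm of `x` to the base `δ`: the class `n` with `δ ^ n = x` (and `0` if there
is none). -/
noncomputable def dlog (q : ℕ) (δ : Eˣ) (x : E) : ZMod (q ^ 2 - 1) :=
  if h : ∃ n : ZMod (q ^ 2 - 1), (dpow δ n : E) = x then h.choose else 0

/-- `x(i,j)`, the index with `δ ^ x(i,j) = 1 + δ ^ (j - i)`. -/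
noncomputable def xIdx (δ : Eˣ) (i j : ZMod (q ^ 2 - 1)) : ZMod (q ^ 2 - 1) :=
  dlog q δ (1 + (dpow δ (j - i) : E))

/-- `y(i,j) = x(i,j) + i - j`. -/
noncomputable def yIdx (δ : Eˣ) (i j : ZMod (q ^ 2 - 1)) : ZMod (q ^ 2 - 1) :=
  xIdx δ i j + i - j

/-- `k(i,j) = j - y(i,j) (q - 1)`. -/
noncomputable def kIdx (δ : Eˣ) (i j : ZMod (q ^ 2 - 1)) : ZMod (q ^ 2 - 1) :=
  j - yIdx δ i j * ((q : ZMod (q ^ 2 - 1)) - 1)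

/-- `l(i,j) = i - x(i,j) (q - 1)`. -/
noncomputable def lIdx (δ : Eˣ) (i j : ZMod (q ^ 2 - 1)) : ZMod (q ^ 2 - 1) :=
  i - xIdx δ i j * ((q : ZMod (q ^ 2 - 1)) - 1)

/-- The generators `d`, `s` and `a i` for `i ∈ M`. -/
inductive Gen (M : Set (ZMod (q ^ 2 - 1))) : Type
  | d : Gen M
  | s : Gen M
  | a (i : M) : Gen M

/-- The relators between the generators `a i`, `i ∈ M`, written in a group `G` in which these
generators are interpreted by `a`. When `M` is a union of cosets of `(q - 1)ℤ / (q² - 1)`, the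
indices `i + (q² - 1) / 2` (for odd `q`), `k(i,j)` and `l(i,j)` lie in `M` again. -/
inductive ARel (M : Set (ZMod (q ^ 2 - 1))) (δ : Eˣ) {G : Type} [Group G] (a : M → G) : G → Prop
  | inv_odd (hq : Odd q) (i i' : M)
      (h : (i' : ZMod (q ^ 2 - 1)) = i + (((q ^ 2 - 1) / 2 : ℕ) : ZMod (q ^ 2 - 1))) :
      ARel M δ a (a i' * a i)
  | inv_even (hq : Even q) (i : M) : ARel M δ a (a i ^ 2)
  | square (i j k l : M) (hij : (i : ZMod (q ^ 2 - 1)) - j ∉ cosetGroup q)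
      (hk : (k : ZMod (q ^ 2 - 1)) = kIdx δ i j) (hl : (l : ZMod (q ^ 2 - 1)) = lIdx δ i j) :
      ARel M δ a (a i * a j * (a k * a l)⁻¹)

/-- The generator `a i` in the free group on all generators. -/
def freeA (M : Set (ZMod (q ^ 2 - 1))) (i : M) : FreeGroup (Gen M) := FreeGroup.of (Gen.a i)

/-- The relators of `Λ_{M,δ}`. When `M` is a union of cosets of `(q - 1)ℤ / (q² - 1)`, the
indices `q i` and `i + 1 - q` lie in `M` again. -/
inductive LambdaRel (M : Set (ZMod (q ^ 2 - 1))) (δ : Eˣ) : FreeGroup (Gen M) → Prop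
  | d_pow : LambdaRel M δ (FreeGroup.of Gen.d ^ (q + 1))
  | s_sq : LambdaRel M δ (FreeGroup.of Gen.s ^ 2)
  | sd_sq : LambdaRel M δ ((FreeGroup.of Gen.s * FreeGroup.of Gen.d) ^ 2)
  | s_conj (i i' : M) (h : (i' : ZMod (q ^ 2 - 1)) = q * i) :
      LambdaRel M δ (FreeGroup.of Gen.s * freeA M i * FreeGroup.of Gen.s * (freeA M i')⁻¹)
  | d_conj (i i' : M) (h : (i' : ZMod (q ^ 2 - 1)) = i + 1 - q) :
      LambdaRel M δ (FreeGroup.of Gen.d * freeA M i * (FreeGroup.of Gen.d)⁻¹ * (freeA M i')⁻¹)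
  | of_a (r : FreeGroup (Gen M)) (h : ARel M δ (freeA M) r) : LambdaRel M δ r

/-- The finitely presented group `Λ_{M,δ}`. -/
abbrev PLambda (M : Set (ZMod (q ^ 2 - 1))) (δ : Eˣ) : Type :=
  PresentedGroup {r | LambdaRel M δ r}

/-- The finitely presented group `Γ_{M,δ}`. -/
abbrev PGamma (M : Set (ZMod (q ^ 2 - 1))) (δ : Eˣ) : Type :=
  PresentedGroup {r | ARel M δ (FreeGroup.of : M → FreeGroup M) r}

/-- The natural homomorphism `Γ_{M,δ} → Λ_{M,δ}`, `a i ↦ a i`. -/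
def gammaToLambda (M : Set (ZMod (q ^ 2 - 1))) (δ : Eˣ) : PGamma M δ →* PLambda M δ :=
  PresentedGroup.toGroup (f := fun i => PresentedGroup.of (Gen.a i)) (by
    have key : ∀ r, LambdaRel M δ r → PresentedGroup.mk {r | LambdaRel M δ r} r = 1 :=
      fun r hr => PresentedGroup.one_of_mem hr
    intro r hr
    refine Eq.trans ?_ (key (FreeGroup.lift (freeA M) r) (LambdaRel.of_a _ ?_))
    · rw [← MonoidHom.comp_apply]
      congr 1
      ext i
      simp [freeA, PresentedGroup.of]
    · cases hr with
      | inv_odd hq i i' h => simpa using ARel.inv_odd hq i i' h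
      | inv_even hq i => simpa using ARel.inv_even hq i
      | square i j k l hij hk hl => simpa only [map_mul, map_inv, FreeGroup.lift_apply_of] using ARel.square i j k l hij hk hl)

end Presentation

/-- The set `S₀ = {δ ^ (-i (q + 1)) : i ∈ M}` of non-zero rational points. -/
def placesOf {𝔽 : Type*} [Field 𝔽] {b c : 𝔽} {q : ℕ} (M : Set (ZMod (q ^ 2 - 1)))
    (δ : (FZ b c)ˣ) : Set 𝔽ˣ :=
  {τ | ∃ i ∈ M, algebraMap 𝔽 (FZ b c) (τ : 𝔽) = (((dpow δ i ^ (q + 1))⁻¹ : (FZ b c)ˣ) : FZ b c)}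

end QuatLattice

open QuatLattice

open Polynomial

namespace QuatLattice

/-! ### Finite field facts -/

section FiniteField

variable {𝔽 : Type*} [Field 𝔽] {b c : 𝔽} {q : ℕ}

/-! Let E = 𝔽[Z], with conjugation α ↦ ᾱ. Over 𝔽[t] the order is the skew polynomial ring E{F} with
F² = t and Fα = ᾱF, and each class in `Lambda` is represented by a skew polynomial, because
denominators of S-integers are S-units. The relations come from (1 + αF)(1 + βF) = 1 + αβ̄t + (α +
β)F. The product depends only on α + β and αβ̄, and with s = α + β these are unchanged when (α, β)
is replaced by (β̄s/s̄, ᾱs/s̄). That is the square relation (`lin_mul_lin_square`). For β = -α the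
product is the scalar 1 - N(α)t.

Surjectivity is factorization into linear factors. The reduced norm of a unit is an S-unit, so if it
is not constant it vanishes at 0 or at some τ in S₀. A zero at 0 splits off F on the right; a zero
at τ splits off some 1 + βF with N(β)τ = 1 (`mem_of_isClass_toQ`). When the reduced norm is
constant, anisotropy of the norm form leaves only a constant of E
(`eq_cst_of_natDegree_nrm_eq_zero`), hence a power of δ.

For injectivity, each element of the presented group is h dⁿ or h dⁿ s with h from Γ
(`exists_eq_mul_dihedral`). The form with s never becomes central, as its F-coefficient at t = 0 is
δⁿ. In the other case, represent h by a shortest word in the a_i. If h dⁿ becomes central, the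
product of linear factors along the word has no F-part. If the word ended in α, this product would
vanish at τ = N(α)⁻¹, hence be divisible on the right by 1 + βF also for some β ≠ α of the same
norm. Then the word without its last letter is divisible by 1 - αF. The presented relations suffice
to move such a right divisor to the end of a word, unless the word can be shortened
(`exists_gword_mul_of`). In either case the original word was not shortest. So the word is empty, δⁿ
lies in 𝔽, and q + 1 divides n. The case n = 0 gives the injectivity on Γ. -/

/-- `δ` generates the unit group of the quadratic extension `𝔽[Z]` with `q²` elements. -/
structure IsGen (q : ℕ) (δ : (FZ b c)ˣ) : Prop where
  two_le : 2 ≤ q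
  frob : ∀ x : FZ b c, x ^ q = star x
  gen : ∀ x : (FZ b c)ˣ, x ∈ Subgroup.zpowers δ
  order : orderOf δ = q ^ 2 - 1
  char_two : Even q → (2 : 𝔽) = 0

theorem two_eq_zero_of_even_card [Fintype 𝔽] (he : Even (Fintype.card 𝔽)) : (2 : 𝔽) = 0 := by
  have h2 := FiniteField.even_card_iff_char_two (F := 𝔽) |>.2 (Nat.even_iff.1 he)
  have := (ringChar.charP 𝔽).cast_eq_zero
  rw [h2] at this
  exact_mod_cast this

theorem IsParam.no_root [Fintype 𝔽] (hq : Fintype.card 𝔽 = q) (h : IsParam q b c) :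
    Fact (∀ r : 𝔽, r ^ 2 ≠ c + b * r) := by
  refine ⟨fun r hr => ?_⟩
  rcases h with ⟨-, rfl, hc⟩ | ⟨he, rfl, hi⟩
  · exact hc ⟨r, by rw [← sq, hr]; ring⟩
  · have h2 : (2 : 𝔽) = 0 := two_eq_zero_of_even_card (hq ▸ he)
    have hroot : (X ^ 2 + X + C c : 𝔽[X]).IsRoot r := by
      simp only [IsRoot.def, eval_add, eval_pow, eval_X, eval_C]
      linear_combination hr + (r + c) * h2
    have h1 : natDegree _ = 1 :=
      natDegree_eq_of_degree_eq_some (degree_eq_one_of_irreducible_of_root hi hroot)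
    have : (X ^ 2 + X + C c : 𝔽[X]).natDegree = 2 := by compute_degree!
    omega

/-- The q-th power map is additive and fixes 𝔽, so it sends Z to a root of the same quadratic. That
root is not Z itself, since otherwise all q² elements would be roots of X^q - X. Hence Frobenius is
the conjugation. -/
theorem isGen_of_card [Fact (∀ r : 𝔽, r ^ 2 ≠ c + b * r)] [Fintype 𝔽] (hq : Fintype.card 𝔽 = q)
    (δ : (FZ b c)ˣ) (hδ : ∀ x : (FZ b c)ˣ, x ∈ Subgroup.zpowers δ) : IsGen q δ := by
  classical
  have h2 : 2 ≤ q := hq ▸ Fintype.one_lt_card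
  let _ : Fintype (FZ b c) := Fintype.ofEquiv _ (QuadraticAlgebra.equivProd c b).symm
  have hcard : Fintype.card (FZ b c) = q ^ 2 := by
    rw [Fintype.card_congr (QuadraticAlgebra.equivProd c b), Fintype.card_prod, hq, sq]
  obtain ⟨p, hp⟩ := CharP.exists 𝔽
  have : CharP (FZ b c) p := charP_of_injective_algebraMap
    (algebraMap 𝔽 (FZ b c)).injective p
  obtain ⟨n, hpp, hn⟩ := FiniteField.card 𝔽 p
  have : Fact p.Prime := ⟨hpp⟩
  have hqp : q = p ^ (n : ℕ) := hq ▸ hn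
  have hF : ∀ x : 𝔽, x ^ q = x := fun x => hq ▸ FiniteField.pow_card x
  have hadd : ∀ x y : FZ b c, (x + y) ^ q = x ^ q + y ^ q := fun x y => by
    rw [hqp]; exact add_pow_char_pow x y p n
  have hmap : ∀ x : 𝔽, (algebraMap 𝔽 (FZ b c) x) ^ q = algebraMap 𝔽 (FZ b c) x := fun x => by
    rw [← map_pow, hF]
  set Z : FZ b c := ⟨0, 1⟩ with hZ
  have hdec : ∀ x : FZ b c, x = algebraMap 𝔽 _ x.re + algebraMap 𝔽 _ x.im * Z := fun x => by
    ext <;> simp [hZ]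
  have hpow : ∀ x : FZ b c, x ^ q = algebraMap 𝔽 _ x.re + algebraMap 𝔽 _ x.im * Z ^ q := fun x => by
    conv_lhs => rw [hdec x]
    rw [hadd, mul_pow, hmap, hmap]
  have hZZ : Z ^ 2 = algebraMap 𝔽 _ c + algebraMap 𝔽 _ b * Z := by
    ext <;> simp [hZ, sq]
  have hroot : (Z ^ q) ^ 2 = algebraMap 𝔽 _ c + algebraMap 𝔽 _ b * Z ^ q := by
    rw [← pow_mul, mul_comm, pow_mul, hZZ, hadd, mul_pow, hmap, hmap]
  have hne : Z ^ q ≠ Z := by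
    intro h
    have hall : ∀ x : FZ b c, x ^ q = x := fun x => by
      rw [hpow, h, ← hdec]
    have hp0 : (X ^ q - X : (FZ b c)[X]) ≠ 0 := FiniteField.X_pow_card_sub_X_ne_zero _ h2
    have hle := Polynomial.card_roots' (X ^ q - X : (FZ b c)[X])
    rw [FiniteField.X_pow_card_sub_X_natDegree_eq _ h2] at hle
    have : Finset.univ ⊆ (X ^ q - X : (FZ b c)[X]).roots.toFinset := fun x _ => by
      simp [hp0, hall x]
    have := (Finset.card_le_card this).trans (Multiset.toFinset_card_le _)
    rw [Finset.card_univ, hcard] at this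
    nlinarith
  have hstarZ : Z ^ q = star Z := by
    have h1 : star Z = algebraMap 𝔽 _ b - Z := by ext <;> simp [hZ]
    have h3 : (Z ^ q - Z) * (Z ^ q - star Z) = 0 := by
      rw [h1]; linear_combination hroot - hZZ
    rcases mul_eq_zero.1 h3 with h | h
    · exact absurd (sub_eq_zero.1 h) hne
    · exact sub_eq_zero.1 h
  refine ⟨h2, fun x => ?_, hδ, ?_, fun he => ?_⟩
  · rw [hpow, hstarZ]
    ext <;> simp [hZ]
    ring
  · rw [orderOf_eq_card_of_forall_mem_zpowers hδ, Nat.card_units, Nat.card_eq_fintype_card, hcard]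
  · exact two_eq_zero_of_even_card (hq ▸ he)

namespace IsGen

variable {δ : (FZ b c)ˣ} (hg : IsGen q δ)
include hg

theorem card_pos : 0 < q ^ 2 - 1 := by
  have := hg.two_le
  have : 4 ≤ q ^ 2 := by nlinarith
  omega

theorem neZero : NeZero (q ^ 2 - 1) := ⟨hg.card_pos.ne'⟩

theorem dpow_natCast (n : ℕ) : dpow δ (n : ZMod (q ^ 2 - 1)) = δ ^ n := by
  rw [dpow, ZMod.val_natCast, ← hg.order, pow_mod_orderOf]

theorem exists_natCast (i : ZMod (q ^ 2 - 1)) : ∃ n : ℕ, (n : ZMod (q ^ 2 - 1)) = i := by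
  have := hg.neZero
  exact ⟨i.val, ZMod.natCast_zmod_val i⟩

theorem dpow_add (i j : ZMod (q ^ 2 - 1)) : dpow δ (i + j) = dpow δ i * dpow δ j := by
  obtain ⟨m, rfl⟩ := hg.exists_natCast i
  obtain ⟨n, rfl⟩ := hg.exists_natCast j
  rw [← Nat.cast_add]
  simp only [hg.dpow_natCast, pow_add]

theorem dpow_sub (i j : ZMod (q ^ 2 - 1)) : dpow δ (i - j) = dpow δ i / dpow δ j := by
  rw [eq_div_iff_mul_eq', ← hg.dpow_add, sub_add_cancel]

theorem dpow_mul_natCast (i : ZMod (q ^ 2 - 1)) (n : ℕ) : dpow δ (i * (n : ZMod (q ^ 2 - 1))) = dpow δ i ^ n := by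
  obtain ⟨m, rfl⟩ := hg.exists_natCast i
  rw [← Nat.cast_mul]
  simp only [hg.dpow_natCast, pow_mul]

theorem dpow_injective : Function.Injective (dpow δ : ZMod (q ^ 2 - 1) → (FZ b c)ˣ) := by
  intro i j h
  obtain ⟨m, rfl⟩ := hg.exists_natCast i
  obtain ⟨n, rfl⟩ := hg.exists_natCast j
  rw [hg.dpow_natCast, hg.dpow_natCast, pow_eq_pow_iff_modEq, hg.order] at h
  exact (ZMod.natCast_eq_natCast_iff _ _ _).2 h

theorem dpow_surjective (x : (FZ b c)ˣ) : ∃ i : ZMod (q ^ 2 - 1), dpow δ i = x := by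
  have h := hg.gen x
  have : IsOfFinOrder δ := orderOf_pos_iff.1 (hg.order ▸ hg.card_pos)
  obtain ⟨n, hn⟩ := this.mem_powers_iff_mem_zpowers.2 h
  exact ⟨n, (hg.dpow_natCast n).trans hn⟩

theorem exists_dpow_eq [Fact (∀ r : 𝔽, r ^ 2 ≠ c + b * r)] {x : FZ b c} (hx : x ≠ 0) :
    ∃ i : ZMod (q ^ 2 - 1), (dpow δ i : FZ b c) = x := by
  obtain ⟨i, hi⟩ := hg.dpow_surjective (Units.mk0 x hx)
  exact ⟨i, by rw [hi]; rfl⟩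

theorem dpow_val_inj {i j : ZMod (q ^ 2 - 1)}
    (h : (dpow δ i : FZ b c) = (dpow δ j : FZ b c)) : i = j :=
  hg.dpow_injective (Units.ext h)

theorem dpow_q_mul (i : ZMod (q ^ 2 - 1)) :
    (dpow δ ((q : ZMod (q ^ 2 - 1)) * i) : FZ b c) = star (dpow δ i : FZ b c) := by
  rw [mul_comm, hg.dpow_mul_natCast, Units.val_pow_eq_pow_val, hg.frob]

theorem algebraMap_norm (x : FZ b c) : algebraMap 𝔽 (FZ b c) (QuadraticAlgebra.norm x) = x ^ (q + 1) := by
  rw [QuadraticAlgebra.algebraMap_norm_eq_mul_star, pow_succ', hg.frob]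

/-- Since N(x) = x^(q+1), equality means that q² - 1 = (q - 1)(q + 1) divides (i - j)(q + 1). Cosets
of (q - 1) are thus exactly the norm fibres. -/
theorem norm_dpow_eq_iff (i j : ZMod (q ^ 2 - 1)) :
    QuadraticAlgebra.norm (dpow δ i : FZ b c) = QuadraticAlgebra.norm (dpow δ j : FZ b c) ↔
      i - j ∈ cosetGroup q := by
  have h2 := hg.two_le
  have hfac : q ^ 2 - 1 = (q - 1) * (q + 1) := by
    have := Nat.sq_sub_sq q 1
    rw [one_pow] at this; rw [this, mul_comm]
  have key : ∀ h : ZMod (q ^ 2 - 1), dpow δ h ^ (q + 1) = 1 ↔ h ∈ cosetGroup q := by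
    intro h
    rw [cosetGroup, AddSubgroup.mem_zmultiples_iff]
    constructor
    · obtain ⟨m, rfl⟩ := hg.exists_natCast h
      rw [hg.dpow_natCast, ← pow_mul, ← orderOf_dvd_iff_pow_eq_one, hg.order, hfac]
      intro hd
      obtain ⟨k, rfl⟩ := Nat.dvd_of_mul_dvd_mul_right (by omega) hd
      refine ⟨k, ?_⟩
      rw [zsmul_eq_mul]
      push_cast [Nat.cast_sub (show 1 ≤ q by omega)]
      ring
    · rintro ⟨k, rfl⟩
      have := hg.neZero
      obtain ⟨m, hm⟩ := hg.exists_natCast (k : ZMod (q ^ 2 - 1))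
      have : (k • ((q : ZMod (q ^ 2 - 1)) - 1)) = ((m * (q - 1) : ℕ) : ZMod (q ^ 2 - 1)) := by
        rw [zsmul_eq_mul, ← hm]
        push_cast [Nat.cast_sub (show 1 ≤ q by omega)]
        ring
      rw [this, hg.dpow_natCast, ← pow_mul, ← orderOf_dvd_iff_pow_eq_one, hg.order, hfac, mul_assoc]
      exact dvd_mul_left _ _
  rw [← key, hg.dpow_sub, div_pow, div_eq_one, ← (algebraMap 𝔽 (FZ b c)).injective.eq_iff,
    hg.algebraMap_norm, hg.algebraMap_norm, ← Units.val_pow_eq_pow_val, ← Units.val_pow_eq_pow_val,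
    Units.val_inj]

theorem dpow_half [Fact (∀ r : 𝔽, r ^ 2 ≠ c + b * r)] (hq : Odd q) :
    (dpow δ (((q ^ 2 - 1) / 2 : ℕ) : ZMod (q ^ 2 - 1)) : FZ b c) = -1 := by
  have h2 := hg.two_le
  have hq2 : Odd (q ^ 2) := hq.pow
  have hpos := hg.card_pos
  obtain ⟨k, hk⟩ := hq2
  have hk' : (q ^ 2 - 1) / 2 = k := by omega
  rw [hk', hg.dpow_natCast]
  have h1 : (δ ^ k) ^ 2 = 1 := by
    rw [← pow_mul, ← orderOf_dvd_iff_pow_eq_one, hg.order]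
    exact ⟨1, by omega⟩
  have h3 : δ ^ k ≠ 1 := by
    rw [Ne, ← orderOf_dvd_iff_pow_eq_one, hg.order]
    intro h
    have := Nat.le_of_dvd (by omega) h
    omega
  rcases sq_eq_one_iff.1 (show ((δ ^ k : (FZ b c)ˣ) : FZ b c) ^ 2 = 1 by
    rw [← Units.val_pow_eq_pow_val, h1]; rfl) with h | h
  · exact absurd (Units.ext h) h3
  · exact h

end IsGen

end FiniteField

/-! ### The reduced norm of a quaternion algebra -/

section ReducedNorm

variable {R : Type*} [CommRing R] {c₁ c₂ c₃ : R}

/-- The reduced norm of a quaternion algebra. -/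
def nrm (x : QuaternionAlgebra R c₁ c₂ c₃) : R :=
  (x.re * x.re + c₂ * x.re * x.imI - c₁ * x.imI * x.imI) -
    c₃ * (x.imJ * x.imJ + c₂ * x.imJ * x.imK - c₁ * x.imK * x.imK)

theorem nrm_mul (x y : QuaternionAlgebra R c₁ c₂ c₃) : nrm (x * y) = nrm x * nrm y := by
  simp only [nrm, QuaternionAlgebra.re_mul, QuaternionAlgebra.imI_mul, QuaternionAlgebra.imJ_mul,
    QuaternionAlgebra.imK_mul]
  ring

theorem nrm_one : nrm (1 : QuaternionAlgebra R c₁ c₂ c₃) = 1 := by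
  simp [nrm]

theorem algebraMap_mul_eq (r : R) (x : QuaternionAlgebra R c₁ c₂ c₃) :
    algebraMap R _ r * x = ⟨r * x.re, r * x.imI, r * x.imJ, r * x.imK⟩ := by
  rw [← Algebra.smul_def]; rfl

theorem isUnit_nrm {x : QuaternionAlgebra R c₁ c₂ c₃} (h : IsUnit x) : IsUnit (nrm x) := by
  obtain ⟨y, hy⟩ := h.exists_right_inv
  exact .of_mul_eq_one (nrm y) (by rw [← nrm_mul, hy, nrm_one])

theorem isUnit_of_isUnit_algebraMap {r : R}
    (h : IsUnit (algebraMap R (QuaternionAlgebra R c₁ c₂ c₃) r)) : IsUnit r := by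
  obtain ⟨y, hy⟩ := h.exists_right_inv
  refine .of_mul_eq_one y.re ?_
  have := congrArg QuaternionAlgebra.re hy
  rwa [algebraMap_mul_eq] at this

end ReducedNorm

/-! ### The order over the polynomial ring -/

section PolyOrder

variable {𝔽 : Type*} [Field 𝔽] {b c : 𝔽}

/-- The order over the polynomial ring, that is, the ring of skew polynomials in `F`. -/
abbrev PolyOrder (b c : 𝔽) : Type _ := QuaternionAlgebra 𝔽[X] (C c) (C b) X

/-- The linear skew polynomial `1 + α F`. -/
noncomputable def lin (α : FZ b c) : PolyOrder b c := ⟨1, 0, C α.re, C α.im⟩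

/-- The constant skew polynomial `α`. -/
noncomputable def cst (α : FZ b c) : PolyOrder b c := ⟨C α.re, C α.im, 0, 0⟩

/-- The skew polynomial `F`. -/
noncomputable def polyF (b c : 𝔽) : PolyOrder b c := ⟨0, 0, 1, 0⟩

/-- The value at `τ` of the `𝔽[Z][X]`-coefficient of `1`. -/
noncomputable def evalU (τ : 𝔽) (x : PolyOrder b c) : FZ b c := ⟨x.re.eval τ, x.imI.eval τ⟩

/-- The value at `τ` of the `𝔽[Z][X]`-coefficient of `F`. -/
noncomputable def evalV (τ : 𝔽) (x : PolyOrder b c) : FZ b c := ⟨x.imJ.eval τ, x.imK.eval τ⟩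

/-- Write x = u + vF with u, v over E[t], and use Fα = ᾱF and F² = t. The two coefficients of a
product, evaluated at t = τ, depend only on those of the factors. -/
theorem evalU_mul (τ : 𝔽) (x y : PolyOrder b c) :
    evalU τ (x * y) = evalU τ x * evalU τ y + algebraMap 𝔽 _ τ * (evalV τ x * star (evalV τ y)) := by
  ext <;> simp [evalU, evalV] <;> ring

theorem evalV_mul (τ : 𝔽) (x y : PolyOrder b c) :
    evalV τ (x * y) = evalU τ x * evalV τ y + evalV τ x * star (evalU τ y) := by
  ext <;> simp [evalU, evalV] <;> ring

theorem evalU_lin (τ : 𝔽) (α : FZ b c) : evalU τ (lin α) = 1 := by ext <;> simp [evalU, lin, QuadraticAlgebra.re_one, QuadraticAlgebra.im_one]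
theorem evalV_lin (τ : 𝔽) (α : FZ b c) : evalV τ (lin α) = α := by ext <;> simp [evalV, lin]
theorem evalU_cst (τ : 𝔽) (α : FZ b c) : evalU τ (cst α) = α := by ext <;> simp [evalU, cst]
theorem evalV_cst (τ : 𝔽) (α : FZ b c) : evalV τ (cst α) = 0 := by ext <;> simp [evalV, cst]
theorem evalU_polyF (τ : 𝔽) : evalU τ (polyF b c) = 0 := by ext <;> simp [evalU, polyF]
theorem evalV_polyF (τ : 𝔽) : evalV τ (polyF b c) = 1 := by ext <;> simp [evalV, polyF, QuadraticAlgebra.re_one, QuadraticAlgebra.im_one]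
theorem evalU_one (τ : 𝔽) : evalU τ (1 : PolyOrder b c) = 1 := by ext <;> simp [evalU, QuadraticAlgebra.re_one, QuadraticAlgebra.im_one]
theorem evalV_one (τ : 𝔽) : evalV τ (1 : PolyOrder b c) = 0 := by ext <;> simp [evalV]

theorem evalU_algebraMap (τ : 𝔽) (f : 𝔽[X]) :
    evalU τ (algebraMap 𝔽[X] (PolyOrder b c) f) = algebraMap 𝔽 _ (f.eval τ) := by
  rw [← mul_one (algebraMap _ _ f), algebraMap_mul_eq]
  ext <;> simp [evalU]

theorem evalV_algebraMap (τ : 𝔽) (f : 𝔽[X]) :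
    evalV τ (algebraMap 𝔽[X] (PolyOrder b c) f) = 0 := by
  rw [← mul_one (algebraMap _ _ f), algebraMap_mul_eq]
  ext <;> simp [evalV]

theorem eval_nrm (τ : 𝔽) (x : PolyOrder b c) :
    (nrm x).eval τ = QuadraticAlgebra.norm (evalU τ x) - τ * QuadraticAlgebra.norm (evalV τ x) := by
  simp [nrm, evalU, evalV, QuadraticAlgebra.norm_def]

theorem nrm_lin (α : FZ b c) : nrm (lin α) = 1 - C (QuadraticAlgebra.norm α) * X := by
  simp only [nrm, lin, QuadraticAlgebra.norm_def]
  simp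
  ring

theorem nrm_polyF : nrm (polyF b c) = - X := by
  simp [nrm, polyF]

/-! ### Products of linear factors, constants and F -/

theorem lin_mul_lin (α β : FZ b c) : lin α * lin β =
    ⟨1 + X * C (α * star β).re, X * C (α * star β).im, C (α + β).re, C (α + β).im⟩ := by
  ext1 <;> simp [lin] <;> ring

theorem lin_mul_lin_eq {α β γ ε : FZ b c} (h₁ : α + β = γ + ε)
    (h₂ : α * star β = γ * star ε) : lin α * lin β = lin γ * lin ε := by
  rw [lin_mul_lin, lin_mul_lin, h₁, h₂]

theorem lin_mul_lin_neg (α : FZ b c) :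
    lin α * lin (-α) = algebraMap 𝔽[X] _ (1 - C (QuadraticAlgebra.norm α) * X) := by
  rw [← mul_one (algebraMap _ _ _), algebraMap_mul_eq, lin_mul_lin]
  have : α * star (-α) = algebraMap 𝔽 _ (- QuadraticAlgebra.norm α) := by
    rw [map_neg, QuadraticAlgebra.algebraMap_norm_eq_mul_star, star_neg, mul_neg]
  rw [this]
  ext1 <;> simp
  ring

theorem lin_neg_mul_lin (α : FZ b c) :
    lin (-α) * lin α = algebraMap 𝔽[X] _ (1 - C (QuadraticAlgebra.norm α) * X) := by
  simpa using lin_mul_lin_neg (-α)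

theorem cst_mul (α β : FZ b c) : cst (α * β) = cst α * cst β := by
  ext1 <;> simp [cst]

theorem cst_one : cst (1 : FZ b c) = 1 := by
  ext1 <;> simp [cst, QuadraticAlgebra.re_one, QuadraticAlgebra.im_one]

theorem cst_algebraMap (r : 𝔽) :
    cst (algebraMap 𝔽 (FZ b c) r) = algebraMap 𝔽[X] _ (C r) := by
  rw [← mul_one (algebraMap 𝔽[X] _ _), algebraMap_mul_eq]
  ext1 <;> simp [cst]

theorem polyF_mul_polyF : polyF b c * polyF b c = algebraMap 𝔽[X] _ X := by
  rw [← mul_one (algebraMap _ _ _), algebraMap_mul_eq]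
  ext1 <;> simp [polyF]

theorem polyF_mul_cst (α : FZ b c) : polyF b c * cst α = cst (star α) * polyF b c := by
  ext1 <;> simp [polyF, cst]

theorem polyF_mul_lin (α : FZ b c) : polyF b c * lin α = lin (star α) * polyF b c := by
  ext1 <;> simp [polyF, lin]
  ring

theorem cst_mul_lin {α β ε : FZ b c} (h : ε * α = β * star ε) :
    cst ε * lin α = lin β * cst ε := by
  have h1 := congrArg (fun x => C x.re) h
  have h2 := congrArg (fun x => C x.im) h
  simp at h1 h2
  ext1 <;> simp [cst, lin]
  · linear_combination h1
  · linear_combination h2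

/-! ### Cancellation of scalars and right division -/

theorem algebraMap_mul_injective {f : 𝔽[X]} (hf : f ≠ 0) {x y : PolyOrder b c}
    (h : algebraMap 𝔽[X] _ f * x = algebraMap 𝔽[X] _ f * y) : x = y := by
  rw [algebraMap_mul_eq, algebraMap_mul_eq, QuaternionAlgebra.ext_iff] at h
  obtain ⟨h1, h2, h3, h4⟩ := h
  ext1
  exacts [mul_left_cancel₀ hf h1, mul_left_cancel₀ hf h2, mul_left_cancel₀ hf h3,
    mul_left_cancel₀ hf h4]

theorem exists_eq_mul_of_eval_eq_zero {τ : 𝔽} {x : PolyOrder b c} (hU : evalU τ x = 0)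
    (hV : evalV τ x = 0) : ∃ y, x = algebraMap 𝔽[X] _ (X - C τ) * y := by
  rw [QuadraticAlgebra.ext_iff] at hU hV
  obtain ⟨y1, h1⟩ := dvd_iff_isRoot.2 (show IsRoot x.re τ from hU.1)
  obtain ⟨y2, h2⟩ := dvd_iff_isRoot.2 (show IsRoot x.imI τ from hU.2)
  obtain ⟨y3, h3⟩ := dvd_iff_isRoot.2 (show IsRoot x.imJ τ from hV.1)
  obtain ⟨y4, h4⟩ := dvd_iff_isRoot.2 (show IsRoot x.imK τ from hV.2)
  refine ⟨⟨y1, y2, y3, y4⟩, ?_⟩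
  rw [algebraMap_mul_eq]
  ext1
  exacts [h1, h2, h3, h4]

/-- The condition for right divisibility by `1 + β F`. -/
theorem exists_eq_mul_lin {β : FZ b c} {τ : 𝔽} (hτ : QuadraticAlgebra.norm β * τ = 1)
    {x : PolyOrder b c} (h : β * evalU τ x = evalV τ x) : ∃ y, x = y * lin β := by
  have hτ0 : τ ≠ 0 := right_ne_zero_of_mul_eq_one hτ
  -- Up to a constant, X - τ equals (1 - βF)(1 + βF). It therefore suffices that x(1 - βF) vanishes
  -- at τ; the central factor X - τ is then cancelled.
  have hN : algebraMap 𝔽 (FZ b c) τ * (β * star β) = 1 := by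
    rw [← QuadraticAlgebra.algebraMap_norm_eq_mul_star, ← map_mul, mul_comm, hτ, map_one]
  obtain ⟨y, hy⟩ := exists_eq_mul_of_eval_eq_zero (τ := τ) (x := x * lin (-β))
    (by rw [evalU_mul, evalU_lin, evalV_lin, ← h, star_neg]
        linear_combination (- evalU τ x) * hN)
    (by rw [evalV_mul, evalU_lin, evalV_lin, ← h, star_one]; ring)
  refine ⟨algebraMap 𝔽[X] _ (C (-τ)) * y, ?_⟩
  refine algebraMap_mul_injective (X_sub_C_ne_zero τ) ?_
  have h1 : (X - C τ : 𝔽[X]) = C (-τ) * (1 - C (QuadraticAlgebra.norm β) * X) := by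
    have : (C (QuadraticAlgebra.norm β) * C τ : 𝔽[X]) = 1 := by rw [← C_mul, hτ, C_1]
    rw [C_neg]
    linear_combination (-X : 𝔽[X]) * this
  calc algebraMap 𝔽[X] _ (X - C τ) * x
      = algebraMap 𝔽[X] _ (C (-τ)) * (x * lin (-β) * lin β) := by
        rw [mul_assoc, lin_neg_mul_lin, ← Algebra.commutes, ← mul_assoc, ← map_mul, ← h1]
    _ = _ := by
        rw [hy]
        simp only [← mul_assoc, ← map_mul]
        rw [mul_comm (C (-τ))]

/-- Writing x = u + vF, a coefficient u that vanishes at 0 has the form u'F², so x = (v + u'F)F. -/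
theorem exists_eq_mul_polyF {x : PolyOrder b c} (h : evalU 0 x = 0) :
    ∃ y, x = y * polyF b c := by
  rw [QuadraticAlgebra.ext_iff] at h
  obtain ⟨y1, h1⟩ := dvd_iff_isRoot.2 (show IsRoot x.re 0 from h.1)
  obtain ⟨y2, h2⟩ := dvd_iff_isRoot.2 (show IsRoot x.imI 0 from h.2)
  rw [C_0, sub_zero] at h1 h2
  refine ⟨⟨x.imJ, x.imK, y1, y2⟩, ?_⟩
  ext1 <;> simp [polyF, h1, h2]

/-- The coefficient in degree 2m is the norm of the pair of coefficients of f and g in degree m.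
That pair is nonzero if m > 0, and the norm is anisotropic, so the top terms cannot cancel. -/
theorem natDegree_norm_form [Fact (∀ r : 𝔽, r ^ 2 ≠ c + b * r)] (f g : 𝔽[X]) :
    (f * f + C b * f * g - C c * g * g).natDegree = 2 * max f.natDegree g.natDegree := by
  set m := max f.natDegree g.natDegree with hm
  have hf : f.natDegree ≤ m := le_max_left _ _
  have hgm : g.natDegree ≤ m := le_max_right _ _
  have hco : (f * f + C b * f * g - C c * g * g).coeff (m + m) =
      QuadraticAlgebra.norm (⟨f.coeff m, g.coeff m⟩ : FZ b c) := by
    rw [QuadraticAlgebra.norm_def, coeff_sub, coeff_add, mul_assoc, mul_assoc, coeff_C_mul, coeff_C_mul,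
      coeff_mul_add_eq_of_natDegree_le hf hf, coeff_mul_add_eq_of_natDegree_le hf hgm,
      coeff_mul_add_eq_of_natDegree_le hgm hgm]
    ring
  have hle : (f * f + C b * f * g - C c * g * g).natDegree ≤ m + m := by
    refine (natDegree_sub_le _ _).trans (max_le ((natDegree_add_le _ _).trans (max_le ?_ ?_)) ?_)
    · exact natDegree_mul_le_of_le hf hf
    · rw [mul_assoc]
      exact (natDegree_C_mul_le _ _).trans (natDegree_mul_le_of_le hf hgm)
    · rw [mul_assoc]
      exact (natDegree_C_mul_le _ _).trans (natDegree_mul_le_of_le hgm hgm)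
  by_cases h0 : m = 0
  · omega
  rw [two_mul]
  refine natDegree_eq_of_le_of_coeff_ne_zero hle ?_
  rw [hco, Ne, QuadraticAlgebra.norm_eq_zero_iff_eq_zero, QuadraticAlgebra.ext_iff]
  rintro ⟨h1, h2⟩
  simp only [QuadraticAlgebra.re_zero, QuadraticAlgebra.im_zero] at h1 h2
  rcases max_choice f.natDegree g.natDegree with h | h
  · rw [← hm] at h
    rw [h, coeff_natDegree, leadingCoeff_eq_zero] at h1
    simp [h1] at h; omega
  · rw [← hm] at h
    rw [h, coeff_natDegree, leadingCoeff_eq_zero] at h2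
    simp [h2] at h; omega

theorem norm_form_eq_zero [Fact (∀ r : 𝔽, r ^ 2 ≠ c + b * r)] {f g : 𝔽[X]}
    (h : f * f + C b * f * g - C c * g * g = 0) : f = 0 ∧ g = 0 := by
  have hd := natDegree_norm_form (b := b) (c := c) f g
  rw [h, natDegree_zero] at hd
  have hf := eq_C_of_natDegree_eq_zero (show f.natDegree = 0 by
    have := le_max_left f.natDegree g.natDegree; omega)
  have hgc := eq_C_of_natDegree_eq_zero (show g.natDegree = 0 by
    have := le_max_right f.natDegree g.natDegree; omega)
  rw [hf, hgc] at h
  simp only [← C_mul, ← C_add, ← C_sub, C_eq_zero] at h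
  have := (QuadraticAlgebra.norm_eq_zero_iff_eq_zero (z := (⟨f.coeff 0, g.coeff 0⟩ : FZ b c))).1 h
  rw [QuadraticAlgebra.ext_iff] at this
  obtain ⟨h1, h2⟩ : f.coeff 0 = 0 ∧ g.coeff 0 = 0 := this
  rw [hf, hgc, h1, h2]
  simp

theorem eq_cst_of_natDegree_nrm_eq_zero [Fact (∀ r : 𝔽, r ^ 2 ≠ c + b * r)] {x : PolyOrder b c}
    (h : (nrm x).natDegree = 0) : ∃ α, x = cst α := by
  set P := x.re * x.re + C b * x.re * x.imI - C c * x.imI * x.imI with hP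
  set Q := x.imJ * x.imJ + C b * x.imJ * x.imK - C c * x.imK * x.imK with hQ
  have hx : P = nrm x + X * Q := by rw [nrm]; ring
  have hPd := natDegree_norm_form (b := b) (c := c) x.re x.imI
  have hQd := natDegree_norm_form (b := b) (c := c) x.imJ x.imK
  rw [← hP] at hPd
  rw [← hQ] at hQd
  by_cases hQ0 : Q = 0
  · obtain ⟨h3, h4⟩ := norm_form_eq_zero hQ0
    rw [hQ0, mul_zero, add_zero] at hx
    rw [hx, h] at hPd
    have hf := eq_C_of_natDegree_eq_zero (show x.re.natDegree = 0 by
      have := le_max_left x.re.natDegree x.imI.natDegree; omega)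
    have hgc := eq_C_of_natDegree_eq_zero (show x.imI.natDegree = 0 by
      have := le_max_right x.re.natDegree x.imI.natDegree; omega)
    refine ⟨⟨x.re.coeff 0, x.imI.coeff 0⟩, ?_⟩
    ext1 <;> simp only [cst]
    exacts [hf, hgc, h3, h4]
  -- The reduced norm is P - XQ, where P has even degree and XQ odd degree. Being constant, it would
  -- force the two degrees to agree.
  · have h1 := natDegree_X_mul hQ0
    have h2 : P.natDegree = (X * Q).natDegree := by
      rw [hx]
      exact natDegree_add_eq_right_of_natDegree_lt (by omega)
    omega

end PolyOrder

/-! ### The `S`-integers -/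

section SIntegers

variable {𝔽 : Type*} [Field 𝔽] {S₀ : Set 𝔽ˣ}

open IsDedekindDomain

theorem algebraMap_SInt_injective : Function.Injective (algebraMap 𝔽[X] (SInt S₀)) := by
  intro f g h
  exact IsFractionRing.injective 𝔽[X] (RatFunc 𝔽) (congrArg Subtype.val h)

theorem isUnit_SInt_of_irreducible {f : 𝔽[X]} (hf : Irreducible f)
    (hS : ∀ v : HeightOneSpectrum 𝔽[X], v.asIdeal = Ideal.span {f} → v ∈ finitePlaces S₀) :
    IsUnit (algebraMap 𝔽[X] (SInt S₀) f) := by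
  have hf0 : algebraMap 𝔽[X] (RatFunc 𝔽) f ≠ 0 := by
    simpa using hf.ne_zero
  have hinv : (algebraMap 𝔽[X] (RatFunc 𝔽) f)⁻¹ ∈ SInt S₀ := by
    intro v hv
    have h1 : v.valuation (RatFunc 𝔽) (algebraMap 𝔽[X] (RatFunc 𝔽) f) = 1 := by
      rw [HeightOneSpectrum.valuation_eq_one_iff_notMem]
      intro hmem
      refine hv (hS v ?_)
      -- A place at which f is not a unit contains the maximal ideal (f), hence equals it and lies
      -- in S.
      have hmax : (Ideal.span {f}).IsMaximal :=
        PrincipalIdealRing.isMaximal_of_irreducible hf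
      exact (hmax.eq_of_le v.isPrime.ne_top ((Ideal.span_singleton_le_iff_mem _).2 hmem)).symm
    rw [map_inv₀, h1, inv_one]
  exact .of_mul_eq_one ⟨_, hinv⟩ (Subtype.ext (mul_inv_cancel₀ hf0))

theorem isUnit_SInt_X : IsUnit (algebraMap 𝔽[X] (SInt S₀) X) :=
  isUnit_SInt_of_irreducible irreducible_X fun _ hv => Or.inl hv

theorem isUnit_SInt_X_sub_C {τ : 𝔽ˣ} (hτ : τ ∈ S₀) :
    IsUnit (algebraMap 𝔽[X] (SInt S₀) (X - C (τ : 𝔽))) :=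
  isUnit_SInt_of_irreducible (irreducible_X_sub_C _) fun _ hv => Or.inr ⟨τ, hτ, hv⟩

theorem isUnit_SInt_C {r : 𝔽} (hr : r ≠ 0) : IsUnit (algebraMap 𝔽[X] (SInt S₀) (C r)) :=
  (isUnit_C.2 hr.isUnit).map _

theorem isRoot_of_irreducible_of_isUnit_SInt {f : 𝔽[X]} (hf : Irreducible f)
    (hu : IsUnit (algebraMap 𝔽[X] (SInt S₀) f)) :
    f.IsRoot 0 ∨ ∃ τ ∈ S₀, f.IsRoot ((τ : 𝔽ˣ) : 𝔽) := by
  let v : HeightOneSpectrum 𝔽[X] :=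
    ⟨Ideal.span {f}, (Ideal.span_singleton_prime hf.ne_zero).2 hf.prime,
      by simpa using hf.ne_zero⟩
  have hv : v ∈ finitePlaces S₀ := by
    by_contra hv
    obtain ⟨y, hy⟩ := hu.exists_right_inv
    have h1 : v.valuation (RatFunc 𝔽) (algebraMap 𝔽[X] (RatFunc 𝔽) f) < 1 := by
      rw [HeightOneSpectrum.valuation_lt_one_iff_mem]
      exact Ideal.mem_span_singleton_self f
    have h2 := y.2 v hv
    have h3 : algebraMap 𝔽[X] (RatFunc 𝔽) f * (y : RatFunc 𝔽) = 1 := congrArg Subtype.val hy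
    have h4 := congrArg (v.valuation (RatFunc 𝔽)) h3
    rw [map_mul, map_one] at h4
    exact (mul_lt_one_of_lt_of_le h1 h2).ne h4
  have key : ∀ r : 𝔽, Ideal.span {f} = Ideal.span {X - C r} → f.IsRoot r := by
    intro r hr
    exact dvd_iff_isRoot.1 (Ideal.span_singleton_le_span_singleton.1 hr.le)
  rcases hv with hv | ⟨τ, hτ, hv⟩
  · exact Or.inl (key 0 (by simpa using hv))
  · exact Or.inr ⟨τ, hτ, key _ hv⟩

theorem isRoot_of_isUnit_SInt {f : 𝔽[X]} (hf : f.natDegree ≠ 0)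
    (hu : IsUnit (algebraMap 𝔽[X] (SInt S₀) f)) :
    f.IsRoot 0 ∨ ∃ τ ∈ S₀, f.IsRoot ((τ : 𝔽ˣ) : 𝔽) := by
  obtain ⟨g, hg, hgf⟩ := exists_irreducible_of_natDegree_ne_zero hf
  rcases isRoot_of_irreducible_of_isUnit_SInt hg
    (isUnit_of_dvd_unit (map_dvd _ hgf) hu) with h | ⟨τ, hτ, h⟩
  · exact Or.inl (h.dvd hgf)
  · exact Or.inr ⟨τ, hτ, h.dvd hgf⟩

/-- For a reduced fraction x = n/d, a Bézout identity a n + e d = 1 gives d(a x + e) = 1. So d is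
already invertible in the S-integers. -/
theorem exists_denominator (x : SInt S₀) : ∃ f g : 𝔽[X],
    IsUnit (algebraMap 𝔽[X] (SInt S₀) f) ∧ algebraMap 𝔽[X] (SInt S₀) f * x = algebraMap _ _ g := by
  obtain ⟨a, e, hae⟩ := RatFunc.isCoprime_num_denom (x : RatFunc 𝔽)
  have hx : algebraMap 𝔽[X] (SInt S₀) (x : RatFunc 𝔽).denom * x =
      algebraMap _ _ (x : RatFunc 𝔽).num := by
    apply Subtype.ext
    change algebraMap 𝔽[X] (RatFunc 𝔽) _ * (x : RatFunc 𝔽) = algebraMap 𝔽[X] (RatFunc 𝔽) _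
    have h := RatFunc.num_div_denom (x : RatFunc 𝔽)
    have h0 : algebraMap 𝔽[X] (RatFunc 𝔽) (x : RatFunc 𝔽).denom ≠ 0 := by
      simpa using RatFunc.denom_ne_zero (x : RatFunc 𝔽)
    rw [div_eq_iff h0] at h
    rw [h, mul_comm]
  refine ⟨_, _, .of_mul_eq_one (algebraMap _ _ a * x + algebraMap _ _ e) ?_, hx⟩
  rw [mul_add, mul_left_comm, hx, ← map_mul, ← map_mul, ← map_add, mul_comm _ e, hae, map_one]

end SIntegers

/-! ### Classes of units of the order -/

section Classes

variable {𝔽 : Type*} [Field 𝔽] {b c : 𝔽}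

/-- The base change of a quaternion algebra along a ring homomorphism. -/
def mapQuaternion {R R' : Type*} [CommRing R] [CommRing R'] (f : R →+* R') (c₁ c₂ c₃ : R) :
    QuaternionAlgebra R c₁ c₂ c₃ →+* QuaternionAlgebra R' (f c₁) (f c₂) (f c₃) where
  toFun x := ⟨f x.re, f x.imI, f x.imJ, f x.imK⟩
  map_one' := by ext1 <;> simp
  map_zero' := by ext1 <;> simp
  map_add' x y := by ext1 <;> simp
  map_mul' x y := by ext1 <;> simp

theorem nrm_mapQuaternion {R R' : Type*} [CommRing R] [CommRing R'] (f : R →+* R') {c₁ c₂ c₃ : R}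
    (x : QuaternionAlgebra R c₁ c₂ c₃) : nrm (mapQuaternion f c₁ c₂ c₃ x) = f (nrm x) := by
  simp [nrm, mapQuaternion]

theorem one_add_mk_mul_mk {R : Type*} [CommRing R] {c₁ c₂ c₃ : R} (u v : R) :
    (1 : QuaternionAlgebra R c₁ c₂ c₃) + ⟨u, v, 0, 0⟩ * ⟨0, 0, 1, 0⟩ = ⟨1, 0, u, v⟩ := by
  ext1 <;> simp

/-- The inclusion of the order over the polynomial ring into the order over the `S`-integers. -/
noncomputable def toQ (S₀ : Set 𝔽ˣ) : PolyOrder b c →+* QOrder b c S₀ :=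
  mapQuaternion (algebraMap 𝔽[X] (SInt S₀)) (C c) (C b) X

theorem toQ_apply (S₀ : Set 𝔽ˣ) (x : PolyOrder b c) : toQ S₀ x =
    ⟨algebraMap _ _ x.re, algebraMap _ _ x.imI, algebraMap _ _ x.imJ, algebraMap _ _ x.imK⟩ := rfl

variable {S₀ : Set 𝔽ˣ}

theorem toQ_cst (α : FZ b c) : toQ S₀ (cst α) = emb S₀ α := by
  simp [toQ_apply, cst, emb, const]
  rfl

theorem toQ_polyF : toQ S₀ (polyF b c) = elemF b c S₀ := by
  simp [toQ_apply, polyF, elemF]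

theorem toQ_lin (α : FZ b c) : toQ S₀ (lin α) = 1 + emb S₀ α * elemF b c S₀ := by
  rw [emb, elemF, one_add_mk_mul_mk]
  simp [toQ_apply, lin, const]
  rfl

theorem toQ_algebraMap (f : 𝔽[X]) :
    toQ S₀ (algebraMap 𝔽[X] (PolyOrder b c) f) = algebraMap (SInt S₀) _ (algebraMap _ _ f) := by
  rw [← mul_one (algebraMap 𝔽[X] (PolyOrder b c) f), algebraMap_mul_eq,
    ← mul_one (algebraMap (SInt S₀) _ _), algebraMap_mul_eq]
  simp [toQ_apply]

theorem nrm_toQ (x : PolyOrder b c) : nrm (toQ S₀ x) = algebraMap _ _ (nrm x) :=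
  nrm_mapQuaternion _ x

theorem exists_toQ_eq (x : QOrder b c S₀) : ∃ (f : 𝔽[X]) (y : PolyOrder b c),
    IsUnit (algebraMap 𝔽[X] (SInt S₀) f) ∧
      algebraMap (SInt S₀) _ (algebraMap 𝔽[X] _ f) * x = toQ S₀ y := by
  obtain ⟨f1, g1, hf1, h1⟩ := exists_denominator x.re
  obtain ⟨f2, g2, hf2, h2⟩ := exists_denominator x.imI
  obtain ⟨f3, g3, hf3, h3⟩ := exists_denominator x.imJ
  obtain ⟨f4, g4, hf4, h4⟩ := exists_denominator x.imK
  refine ⟨f1 * f2 * f3 * f4, ⟨f2 * f3 * f4 * g1, f1 * f3 * f4 * g2, f1 * f2 * f4 * g3,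
    f1 * f2 * f3 * g4⟩, ?_, ?_⟩
  · simp only [map_mul]
    exact ((hf1.mul hf2).mul hf3).mul hf4
  · rw [algebraMap_mul_eq]
    ext1 <;> simp only [toQ_apply, map_mul]
    · rw [← h1]; ring
    · rw [← h2]; ring
    · rw [← h3]; ring
    · rw [← h4]; ring

theorem IsClass.mul {g h : Lambda b c S₀} {x y : QOrder b c S₀} (hx : IsClass g x)
    (hy : IsClass h y) : IsClass (g * h) (x * y) := by
  obtain ⟨u, rfl, rfl⟩ := hx
  obtain ⟨v, rfl, rfl⟩ := hy
  exact ⟨u * v, rfl, rfl⟩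

theorem IsClass.one : IsClass (1 : Lambda b c S₀) 1 := ⟨1, rfl, rfl⟩

/-- The scalar need not be assumed invertible: it is a quotient of two units of the order, and the
first coordinate of its inverse there inverts it. -/
theorem IsClass.eq_of_smul {g h : Lambda b c S₀} {x y : QOrder b c S₀} (hx : IsClass g x)
    (hy : IsClass h y) {r : SInt S₀} (hr : algebraMap (SInt S₀) _ r * x = y) : g = h := by
  obtain ⟨u, rfl, rfl⟩ := hx
  obtain ⟨v, rfl, rfl⟩ := hy
  have hru : algebraMap (SInt S₀) (QOrder b c S₀) r = (v * u⁻¹ : (QOrder b c S₀)ˣ) := by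
    rw [Units.val_mul, ← hr, mul_assoc, Units.mul_inv, mul_one]
  have hunit : IsUnit r := isUnit_of_isUnit_algebraMap (hru ▸ Units.isUnit _)
  rw [QuotientGroup.eq]
  refine ⟨hunit.unit, ?_⟩
  ext1
  change algebraMap (SInt S₀) (QOrder b c S₀) r = (u⁻¹ * v : (QOrder b c S₀)ˣ)
  rw [Units.val_mul, ← hr, ← mul_assoc, ← Algebra.commutes, mul_assoc, Units.inv_mul, mul_one]

theorem IsClass.exists_eq_algebraMap {x : QOrder b c S₀} (hx : IsClass (1 : Lambda b c S₀) x) :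
    ∃ r : SInt S₀, x = algebraMap (SInt S₀) _ r := by
  obtain ⟨u, rfl, hu⟩ := hx
  obtain ⟨r, rfl⟩ := (QuotientGroup.eq_one_iff u).1 hu
  exact ⟨r, rfl⟩

theorem exists_isClass {x : QOrder b c S₀} (hx : IsUnit x) : ∃ g : Lambda b c S₀, IsClass g x := by
  obtain ⟨u, rfl⟩ := hx
  exact ⟨_, u, rfl, rfl⟩

theorem exists_eq_algebraMap_of_isClass {x : PolyOrder b c}
    (hx : IsClass (1 : Lambda b c S₀) (toQ S₀ x)) :
    ∃ f : 𝔽[X], x = algebraMap 𝔽[X] _ f := by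
  obtain ⟨r, hr⟩ := hx.exists_eq_algebraMap
  rw [← mul_one (algebraMap (SInt S₀) _ _), algebraMap_mul_eq, QuaternionAlgebra.ext_iff] at hr
  obtain ⟨-, h2, h3, h4⟩ := hr
  simp only [QuaternionAlgebra.imI_one, QuaternionAlgebra.imJ_one, QuaternionAlgebra.imK_one,
    mul_zero] at h2 h3 h4
  refine ⟨x.re, ?_⟩
  rw [← mul_one (algebraMap 𝔽[X] _ _), algebraMap_mul_eq]
  ext1
  · simp
  · exact algebraMap_SInt_injective (h2.trans (by simp))
  · exact algebraMap_SInt_injective (h3.trans (by simp))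
  · exact algebraMap_SInt_injective (h4.trans (by simp))

theorem isUnit_toQ_cst {α : FZ b c} (hα : IsUnit α) : IsUnit (toQ S₀ (cst α)) := by
  obtain ⟨u, rfl⟩ := hα
  refine IsUnit.map (toQ S₀) (isUnit_iff_exists.2 ⟨cst ((u⁻¹ : (FZ b c)ˣ) : FZ b c), ?_, ?_⟩)
  · rw [← cst_mul, Units.mul_inv, cst_one]
  · rw [← cst_mul, Units.inv_mul, cst_one]

/-- F² = t is invertible because the places 0 and ∞ belong to S. -/
theorem isUnit_toQ_polyF : IsUnit (toQ S₀ (polyF b c)) := by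
  have h : IsUnit (toQ S₀ (polyF b c) * toQ S₀ (polyF b c)) := by
    rw [← map_mul, polyF_mul_polyF, toQ_algebraMap]
    exact isUnit_SInt_X.map _
  exact (Commute.isUnit_mul_iff (Commute.refl _)).1 h |>.1

theorem isUnit_toQ_lin {α : FZ b c} {τ : 𝔽ˣ} (hτ : τ ∈ S₀)
    (hα : QuadraticAlgebra.norm α * (τ : 𝔽) = 1) : IsUnit (toQ S₀ (lin α)) := by
  have hu : IsUnit (algebraMap 𝔽[X] (SInt S₀) (1 - C (QuadraticAlgebra.norm α) * X)) := by
    have : (1 - C (QuadraticAlgebra.norm α) * X : 𝔽[X]) =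
        C (-QuadraticAlgebra.norm α) * (X - C (τ : 𝔽)) := by
      have : (C (QuadraticAlgebra.norm α) * C (τ : 𝔽) : 𝔽[X]) = 1 := by rw [← C_mul, hα, C_1]
      rw [C_neg]
      linear_combination -this
    rw [this, map_mul]
    exact (isUnit_SInt_C (neg_ne_zero.2 (left_ne_zero_of_mul_eq_one hα))).mul
      (isUnit_SInt_X_sub_C hτ)
  have hc : Commute (toQ S₀ (lin α)) (toQ S₀ (lin (-α))) := by
    rw [Commute, SemiconjBy, ← map_mul, ← map_mul, lin_mul_lin_neg, lin_neg_mul_lin]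
  refine (hc.isUnit_mul_iff.1 ?_).1
  rw [← map_mul, lin_mul_lin_neg, toQ_algebraMap]
  exact hu.map _

variable [Fact (∀ r : 𝔽, r ^ 2 ≠ c + b * r)]

/-- Induction on the degree of the reduced norm, splitting off linear factors. -/
theorem mem_of_isClass_toQ {H : Subgroup (Lambda b c S₀)}
    (hcst : ∀ (α : FZ b c) (g : Lambda b c S₀), α ≠ 0 → IsClass g (toQ S₀ (cst α)) → g ∈ H)
    (hF : ∀ g : Lambda b c S₀, IsClass g (toQ S₀ (polyF b c)) → g ∈ H)
    (hlin : ∀ τ ∈ S₀, ∀ (α : FZ b c) (g : Lambda b c S₀),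
      QuadraticAlgebra.norm α * (τ : 𝔽) = 1 → IsClass g (toQ S₀ (lin α)) → g ∈ H)
    (hex : ∀ τ ∈ S₀, ∃ α : FZ b c, QuadraticAlgebra.norm α * (τ : 𝔽) = 1)
    (n : ℕ) : ∀ (x : PolyOrder b c) (g : Lambda b c S₀), (nrm x).natDegree = n →
      IsClass g (toQ S₀ x) → g ∈ H := by
  induction n with
  | zero =>
    intro x g hn hg
    obtain ⟨α, rfl⟩ := eq_cst_of_natDegree_nrm_eq_zero hn
    refine hcst α g ?_ hg
    rintro rfl
    obtain ⟨u, hu, -⟩ := hg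
    have : toQ S₀ (cst (0 : FZ b c)) = 0 := by ext1 <;> simp [toQ_apply, cst]
    exact u.ne_zero (hu.trans this)
  | succ n ih =>
    intro x g hn hg
    have hux : IsUnit (toQ S₀ x) := by
      obtain ⟨u, hu, -⟩ := hg
      exact hu ▸ u.isUnit
    -- Splitting off a unit right factor z of norm degree one leaves y with norm degree n, to which
    -- the induction hypothesis applies.
    have step : ∀ y z : PolyOrder b c, x = y * z → IsUnit (toQ S₀ z) → (nrm z).natDegree = 1 →
        (∀ h : Lambda b c S₀, IsClass h (toQ S₀ z) → h ∈ H) → g ∈ H := by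
      rintro y z rfl hz hz1 hH
      rw [map_mul] at hux
      have hy : IsUnit (toQ S₀ y) := by
        obtain ⟨u, hu⟩ := hz
        rw [← hu] at hux
        exact (Units.isUnit_mul_units _ u).1 hux
      obtain ⟨gy, hgy⟩ := exists_isClass hy
      obtain ⟨gz, hgz⟩ := exists_isClass hz
      have hprod := hgy.mul hgz
      rw [← map_mul] at hprod
      have hg' : g = gy * gz := hg.eq_of_smul hprod (r := 1) (by rw [map_one, one_mul])
      rw [hg']
      refine H.mul_mem (ih y gy ?_ hgy) (hH gz hgz)
      have h0 : nrm y * nrm z ≠ 0 := by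
        intro h
        rw [nrm_mul, h, natDegree_zero] at hn
        omega
      rw [nrm_mul, natDegree_mul (left_ne_zero_of_mul h0) (right_ne_zero_of_mul h0), hz1] at hn
      omega
    have hun : IsUnit (algebraMap 𝔽[X] (SInt S₀) (nrm x)) := by
      rw [← nrm_toQ (b := b) (c := c)]
      exact isUnit_nrm hux
    rcases isRoot_of_isUnit_SInt (by omega) hun with h | ⟨τ, hτ, h⟩
    · rw [IsRoot.def, eval_nrm, zero_mul, sub_zero, QuadraticAlgebra.norm_eq_zero_iff_eq_zero] at h
      obtain ⟨y, hy⟩ := exists_eq_mul_polyF h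
      exact step y _ hy isUnit_toQ_polyF (by rw [nrm_polyF, natDegree_neg, natDegree_X]) hF
    · rw [IsRoot.def, eval_nrm, sub_eq_zero] at h
      obtain ⟨β, hβ, hβx⟩ : ∃ β : FZ b c, QuadraticAlgebra.norm β * (τ : 𝔽) = 1 ∧
          β * evalU (τ : 𝔽) x = evalV (τ : 𝔽) x := by
        -- The norm condition reads N(u) = τN(v) at τ. If u = 0 then v = 0, and every β of norm τ⁻¹
        -- works; otherwise β = v/u is forced.
        by_cases hU : evalU (τ : 𝔽) x = 0
        · obtain ⟨β, hβ⟩ := hex τ hτ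
          refine ⟨β, hβ, ?_⟩
          rw [hU, QuadraticAlgebra.norm_zero, eq_comm, mul_eq_zero,
            QuadraticAlgebra.norm_eq_zero_iff_eq_zero] at h
          rw [hU, mul_zero, h.resolve_left τ.ne_zero]
        · refine ⟨evalV (τ : 𝔽) x / evalU (τ : 𝔽) x, ?_, div_mul_cancel₀ _ hU⟩
          have hN : QuadraticAlgebra.norm (evalU (τ : 𝔽) x) ≠ 0 :=
            fun h => hU (QuadraticAlgebra.norm_eq_zero_iff_eq_zero.1 h)
          refine mul_right_cancel₀ hN ?_
          rw [mul_right_comm, ← map_mul, div_mul_cancel₀ _ hU, mul_comm, ← h, one_mul]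
      obtain ⟨y, hy⟩ := exists_eq_mul_lin hβ hβx
      refine step y _ hy (isUnit_toQ_lin hτ hβ) ?_ fun g hg => hlin τ hτ β g hβ hg
      have hb := left_ne_zero_of_mul_eq_one hβ
      rw [nrm_lin, ← natDegree_neg, neg_sub]
      rw [sub_eq_add_neg, ← C_1, ← C_neg]
      exact natDegree_linear hb

theorem eq_top_of_isClass_mem {H : Subgroup (Lambda b c S₀)}
    (hcst : ∀ (α : FZ b c) (g : Lambda b c S₀), α ≠ 0 → IsClass g (toQ S₀ (cst α)) → g ∈ H)
    (hF : ∀ g : Lambda b c S₀, IsClass g (toQ S₀ (polyF b c)) → g ∈ H)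
    (hlin : ∀ τ ∈ S₀, ∀ (α : FZ b c) (g : Lambda b c S₀),
      QuadraticAlgebra.norm α * (τ : 𝔽) = 1 → IsClass g (toQ S₀ (lin α)) → g ∈ H)
    (hex : ∀ τ ∈ S₀, ∃ α : FZ b c, QuadraticAlgebra.norm α * (τ : 𝔽) = 1) : H = ⊤ := by
  rw [eq_top_iff]
  intro g _
  obtain ⟨u, rfl⟩ := QuotientGroup.mk_surjective g
  obtain ⟨f, y, hf, hy⟩ := exists_toQ_eq (u : QOrder b c S₀)
  have hyu : IsUnit (toQ S₀ y) := by
    rw [← hy]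
    exact (hf.map (algebraMap (SInt S₀) (QOrder b c S₀))).mul u.isUnit
  obtain ⟨h, hh⟩ := exists_isClass hyu
  have hgh : (QuotientGroup.mk u : Lambda b c S₀) = h := IsClass.eq_of_smul ⟨u, rfl, rfl⟩ hh hy
  rw [hgh]
  exact mem_of_isClass_toQ hcst hF hlin hex _ y h rfl hh

end Classes

/-! ### The homomorphism from the presented group -/

section Homomorphism

variable {𝔽 : Type*} [Field 𝔽] {b c : 𝔽} {q : ℕ}

theorem cst_pow (α : FZ b c) (n : ℕ) : cst (α ^ n) = cst α ^ n := by
  induction n with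
  | zero => rw [pow_zero, pow_zero, cst_one]
  | succ n ih => rw [pow_succ, pow_succ, cst_mul, ih]

theorem IsClass.pow {S₀ : Set 𝔽ˣ} {g : Lambda b c S₀} {x : QOrder b c S₀} (hx : IsClass g x)
    (n : ℕ) : IsClass (g ^ n) (x ^ n) := by
  induction n with
  | zero => rw [pow_zero, pow_zero]; exact IsClass.one
  | succ n ih => rw [pow_succ, pow_succ]; exact ih.mul hx

theorem IsClass.mul_toQ {S₀ : Set 𝔽ˣ} {g h : Lambda b c S₀} {x y : PolyOrder b c}
    (hx : IsClass g (toQ S₀ x)) (hy : IsClass h (toQ S₀ y)) : IsClass (g * h) (toQ S₀ (x * y)) := by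
  rw [map_mul]
  exact hx.mul hy

theorem IsClass.eq_of_toQ {S₀ : Set 𝔽ˣ} {g h : Lambda b c S₀} {x : PolyOrder b c}
    (hx : IsClass g (toQ S₀ x)) (hy : IsClass h (toQ S₀ x)) : g = h :=
  hx.eq_of_smul hy (r := 1) (by rw [map_one, one_mul])

theorem IsClass.eq_of_toQ_smul {S₀ : Set 𝔽ˣ} {g h : Lambda b c S₀} {x y : PolyOrder b c}
    (hx : IsClass g (toQ S₀ x)) (hy : IsClass h (toQ S₀ y)) {f : 𝔽[X]}
    (hf : x = algebraMap 𝔽[X] _ f * y) : g = h := by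
  refine (hy.eq_of_smul hx (r := algebraMap _ _ f) ?_).symm
  rw [hf, map_mul, toQ_algebraMap]

theorem IsClass.eq_one_of_toQ {S₀ : Set 𝔽ˣ} {g : Lambda b c S₀} {x : PolyOrder b c}
    (hx : IsClass g (toQ S₀ x)) {f : 𝔽[X]} (hf : x = algebraMap 𝔽[X] _ f) : g = 1 := by
  refine hx.eq_of_toQ_smul (y := 1) (f := f) ?_ (by rw [hf, mul_one])
  rw [map_one]
  exact IsClass.one

open Classical in
/-- The class of an element of the order over the polynomial ring (and `1` if it is not a unit). -/
noncomputable def cls (S₀ : Set 𝔽ˣ) (x : PolyOrder b c) : Lambda b c S₀ :=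
  if h : IsUnit (toQ S₀ x) then QuotientGroup.mk h.unit else 1

theorem isClass_cls {S₀ : Set 𝔽ˣ} {x : PolyOrder b c} (h : IsUnit (toQ S₀ x)) :
    IsClass (cls S₀ x) (toQ S₀ x) :=
  ⟨h.unit, rfl, by rw [cls, dif_pos h]⟩

variable [Fact (∀ r : 𝔽, r ^ 2 ≠ c + b * r)] {δ : (FZ b c)ˣ}

theorem norm_ne_zero_of_unit (u : (FZ b c)ˣ) : QuadraticAlgebra.norm (u : FZ b c) ≠ 0 :=
  fun h => u.ne_zero (QuadraticAlgebra.norm_eq_zero_iff_eq_zero.1 h)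

namespace IsGen

variable (hg : IsGen q δ)
include hg

/-! ### Closed forms for the indices k and l -/

theorem dpow_dlog {x : FZ b c} (hx : x ≠ 0) : (dpow δ (dlog q δ x) : FZ b c) = x := by
  have h : ∃ n : ZMod (q ^ 2 - 1), (dpow δ n : FZ b c) = x := hg.exists_dpow_eq hx
  rw [dlog, dif_pos h]
  exact h.choose_spec

omit [Fact (∀ r : 𝔽, r ^ 2 ≠ c + b * r)] in
theorem add_ne_zero_of_not_mem {i j : ZMod (q ^ 2 - 1)} (hij : i - j ∉ cosetGroup q) :
    (dpow δ i : FZ b c) + dpow δ j ≠ 0 := by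
  intro h
  refine hij ((hg.norm_dpow_eq_iff i j).1 ?_)
  rw [eq_neg_of_add_eq_zero_left h, QuadraticAlgebra.norm_neg]

theorem dpow_xIdx {i j : ZMod (q ^ 2 - 1)} (hij : i - j ∉ cosetGroup q) :
    (dpow δ (xIdx δ i j) : FZ b c) = (dpow δ i + dpow δ j) / dpow δ i := by
  have h : (1 + (dpow δ (j - i) : FZ b c)) = (dpow δ i + dpow δ j) / dpow δ i := by
    rw [hg.dpow_sub, Units.val_div_eq_div_val, add_div, div_self (dpow δ i).ne_zero]
  rw [xIdx, h]
  exact hg.dpow_dlog (div_ne_zero (hg.add_ne_zero_of_not_mem hij) (dpow δ i).ne_zero)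

/-- Subtracting x(q - 1) from an exponent multiplies by z/z̄ with z = δ^x, because Frobenius is the
conjugation. -/
theorem dpow_sub_mul (i x : ZMod (q ^ 2 - 1)) :
    (dpow δ (i - x * ((q : ZMod (q ^ 2 - 1)) - 1)) : FZ b c) =
      dpow δ i * dpow δ x / star (dpow δ x : FZ b c) := by
  have : i - x * ((q : ZMod (q ^ 2 - 1)) - 1) = i + x - x * (q : ZMod (q ^ 2 - 1)) := by ring
  rw [this, hg.dpow_sub, hg.dpow_add, hg.dpow_mul_natCast, Units.val_div_eq_div_val, Units.val_mul,
    Units.val_pow_eq_pow_val, hg.frob]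

/-- Put α = δ^i, β = δ^j, s = α + β. Then δ^y = s/β, and multiplying β by the ratio of s/β to its
conjugate gives β̄s/s̄. -/
theorem dpow_kIdx {i j : ZMod (q ^ 2 - 1)} (hij : i - j ∉ cosetGroup q) :
    (dpow δ (kIdx δ i j) : FZ b c) =
      (dpow δ i + dpow δ j) / star (dpow δ i + dpow δ j : FZ b c) * star (dpow δ j : FZ b c) := by
  have hy : (dpow δ (yIdx δ i j) : FZ b c) = (dpow δ i + dpow δ j) / dpow δ j := by
    rw [yIdx, hg.dpow_sub, hg.dpow_add, Units.val_div_eq_div_val, Units.val_mul, hg.dpow_xIdx hij,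
      div_mul_cancel₀ _ (dpow δ i).ne_zero]
  have h1 := star_ne_zero.2 (hg.add_ne_zero_of_not_mem hij)
  have h2 := star_ne_zero.2 (dpow δ j).ne_zero
  have h3 := (dpow δ j).ne_zero
  rw [kIdx, hg.dpow_sub_mul, hy, star_div₀]
  field_simp

theorem dpow_lIdx {i j : ZMod (q ^ 2 - 1)} (hij : i - j ∉ cosetGroup q) :
    (dpow δ (lIdx δ i j) : FZ b c) =
      (dpow δ i + dpow δ j) / star (dpow δ i + dpow δ j : FZ b c) * star (dpow δ i : FZ b c) := by
  have h1 := star_ne_zero.2 (hg.add_ne_zero_of_not_mem hij)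
  have h2 := star_ne_zero.2 (dpow δ i).ne_zero
  have h3 := (dpow δ i).ne_zero
  rw [lIdx, hg.dpow_sub_mul, hg.dpow_xIdx hij, star_div₀]
  field_simp

theorem lin_mul_lin_square {i j : ZMod (q ^ 2 - 1)} (hij : i - j ∉ cosetGroup q) :
    lin (dpow δ i : FZ b c) * lin (dpow δ j : FZ b c) =
      lin (dpow δ (kIdx δ i j) : FZ b c) * lin (dpow δ (lIdx δ i j) : FZ b c) := by
  have h0 := hg.add_ne_zero_of_not_mem hij
  have h1 := star_ne_zero.2 h0
  apply lin_mul_lin_eq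
  · rw [hg.dpow_kIdx hij, hg.dpow_lIdx hij, ← mul_add, ← star_add, add_comm (dpow δ j : FZ b c),
      div_mul_cancel₀ _ h1]
  · rw [hg.dpow_kIdx hij, hg.dpow_lIdx hij, star_mul', star_div₀, star_star, star_star]
    field_simp

theorem dpow_add_half {i i' : ZMod (q ^ 2 - 1)} (hq : Odd q)
    (h : i' = i + (((q ^ 2 - 1) / 2 : ℕ) : ZMod (q ^ 2 - 1))) :
    (dpow δ i' : FZ b c) = - (dpow δ i : FZ b c) := by
  rw [h, hg.dpow_add, Units.val_mul, hg.dpow_half hq, mul_neg_one]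

omit [Fact (∀ r : 𝔽, r ^ 2 ≠ c + b * r)] in
theorem neg_eq_self (hq : Even q) (x : FZ b c) : -x = x := by
  have h2 := hg.char_two hq
  rw [neg_eq_iff_add_eq_zero]
  ext
  · simp only [QuadraticAlgebra.re_add, QuadraticAlgebra.re_zero]
    linear_combination x.re * h2
  · simp only [QuadraticAlgebra.im_add, QuadraticAlgebra.im_zero]
    linear_combination x.im * h2

variable {M : Set (ZMod (q ^ 2 - 1))}

theorem exists_place {i : ZMod (q ^ 2 - 1)} (hi : i ∈ M) :
    ∃ τ ∈ placesOf M δ, QuadraticAlgebra.norm (dpow δ i : FZ b c) * (τ : 𝔽) = 1 := by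
  have h0 := norm_ne_zero_of_unit (dpow δ i)
  refine ⟨(Units.mk0 _ h0)⁻¹, ⟨i, hi, ?_⟩, ?_⟩
  · rw [Units.val_inv_eq_inv_val, Units.val_mk0, map_inv₀, hg.algebraMap_norm,
      Units.val_inv_eq_inv_val, Units.val_pow_eq_pow_val]
  · rw [Units.val_inv_eq_inv_val, Units.val_mk0, mul_inv_cancel₀ h0]

omit [Fact (∀ r : 𝔽, r ^ 2 ≠ c + b * r)] in
theorem norm_mul_of_mem_placesOf {τ : 𝔽ˣ} (hτ : τ ∈ placesOf M δ) :
    ∃ i ∈ M, QuadraticAlgebra.norm (dpow δ i : FZ b c) * (τ : 𝔽) = 1 := by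
  obtain ⟨i, hi, h⟩ := hτ
  refine ⟨i, hi, (algebraMap 𝔽 (FZ b c)).injective ?_⟩
  rw [map_mul, h, hg.algebraMap_norm, map_one, ← Units.val_pow_eq_pow_val, Units.mul_inv]

/-- The elements of a given nonzero norm form one coset of exponents, and M is a union of such
cosets. -/
theorem exists_index (hM : ∀ i ∈ M, ∀ h ∈ cosetGroup q, i + h ∈ M) {i : ZMod (q ^ 2 - 1)}
    (hi : i ∈ M) {α : FZ b c}
    (h : QuadraticAlgebra.norm α = QuadraticAlgebra.norm (dpow δ i : FZ b c)) :
    ∃ j : M, (dpow δ (j : ZMod (q ^ 2 - 1)) : FZ b c) = α := by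
  have hα : α ≠ 0 := by
    rintro rfl
    rw [QuadraticAlgebra.norm_zero] at h
    exact norm_ne_zero_of_unit _ h.symm
  obtain ⟨j, rfl⟩ := hg.exists_dpow_eq hα
  refine ⟨⟨j, ?_⟩, rfl⟩
  have := hM i hi _ ((hg.norm_dpow_eq_iff j i).1 h)
  rwa [add_sub_cancel] at this

theorem exists_index_of_place (hM : ∀ i ∈ M, ∀ h ∈ cosetGroup q, i + h ∈ M) {τ : 𝔽ˣ}
    (hτ : τ ∈ placesOf M δ) {α : FZ b c} (h : QuadraticAlgebra.norm α * (τ : 𝔽) = 1) :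
    ∃ j : M, (dpow δ (j : ZMod (q ^ 2 - 1)) : FZ b c) = α := by
  obtain ⟨i, hi, hiτ⟩ := hg.norm_mul_of_mem_placesOf hτ
  exact hg.exists_index hM hi (mul_right_cancel₀ τ.ne_zero (h.trans hiτ.symm))

theorem isClass_lin (i : M) :
    IsClass (cls (placesOf M δ) (lin (dpow δ (i : ZMod (q ^ 2 - 1)) : FZ b c)))
      (toQ (placesOf M δ) (lin (dpow δ (i : ZMod (q ^ 2 - 1)) : FZ b c))) := by
  obtain ⟨τ, hτ, h⟩ := hg.exists_place i.2
  exact isClass_cls (isUnit_toQ_lin hτ h)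

end IsGen

/-- The images in `Λ_S` of the generators. -/
noncomputable def genMap (δ : (FZ b c)ˣ) (M : Set (ZMod (q ^ 2 - 1))) :
    Gen M → Lambda b c (placesOf M δ)
  | .d => cls _ (cst (δ : FZ b c))
  | .s => cls _ (polyF b c)
  | .a i => cls _ (lin (dpow δ (i : ZMod (q ^ 2 - 1)) : FZ b c))

theorem isClass_cst (δ : (FZ b c)ˣ) (S₀ : Set 𝔽ˣ) :
    IsClass (cls S₀ (cst (δ : FZ b c))) (toQ S₀ (cst (δ : FZ b c))) :=
  isClass_cls (isUnit_toQ_cst δ.isUnit)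

omit [Fact (∀ r : 𝔽, r ^ 2 ≠ c + b * r)] in
theorem isClass_polyF (S₀ : Set 𝔽ˣ) :
    IsClass (cls S₀ (polyF b c)) (toQ S₀ (polyF b c)) :=
  isClass_cls isUnit_toQ_polyF

namespace IsGen

variable (hg : IsGen q δ) {M : Set (ZMod (q ^ 2 - 1))}
include hg

theorem lift_genMap_eq_one (r : FreeGroup (Gen M)) (hr : LambdaRel M δ r) :
    FreeGroup.lift (genMap δ M) r = 1 := by
  have hd := isClass_cst δ (placesOf M δ)
  have hs := isClass_polyF (b := b) (c := c) (placesOf M δ)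
  have ha := hg.isClass_lin (M := M)
  cases hr with
  | d_pow =>
    simp only [map_pow, FreeGroup.lift_apply_of, genMap]
    have h := hd.pow (q + 1)
    rw [← map_pow, ← cst_pow, ← hg.algebraMap_norm, cst_algebraMap] at h
    exact h.eq_one_of_toQ rfl
  | s_sq =>
    simp only [map_mul, FreeGroup.lift_apply_of, genMap, sq]
    exact (hs.mul_toQ hs).eq_one_of_toQ polyF_mul_polyF
  | sd_sq =>
    simp only [map_mul, FreeGroup.lift_apply_of, genMap, sq]
    -- (Fδ)² = δ̄F²δ = tN(δ) is central.
    have h := hs.mul_toQ hd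
    refine (h.mul_toQ h).eq_one_of_toQ
      (f := X * C (QuadraticAlgebra.norm (δ : FZ b c))) ?_
    rw [polyF_mul_cst, mul_assoc, ← mul_assoc (polyF b c), polyF_mul_cst, star_star,
      mul_assoc, ← mul_assoc (cst _), polyF_mul_polyF, ← Algebra.commutes, map_mul,
      ← cst_algebraMap, QuadraticAlgebra.algebraMap_norm_eq_mul_star, ← cst_mul,
      mul_comm (star (δ : FZ b c))]
  | s_conj i i' h =>
    simp only [map_mul, map_inv, FreeGroup.lift_apply_of, genMap, freeA]
    rw [mul_inv_eq_one]
    refine ((hs.mul_toQ (ha i)).mul_toQ hs).eq_of_toQ_smul (ha i') (f := X) ?_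
    rw [polyF_mul_lin, mul_assoc, polyF_mul_polyF, ← Algebra.commutes, h, hg.dpow_q_mul]
  | d_conj i i' h =>
    simp only [map_mul, map_inv, FreeGroup.lift_apply_of, genMap, freeA]
    rw [mul_inv_eq_one, mul_inv_eq_iff_eq_mul]
    refine (hd.mul_toQ (ha i)).eq_of_toQ ?_
    rw [cst_mul_lin (β := dpow δ (i' : ZMod (q ^ 2 - 1)))]
    · exact (ha i').mul_toQ hd
    · have h1 : dpow δ (1 : ZMod (q ^ 2 - 1)) = δ := by simpa using hg.dpow_natCast 1
      rw [h, hg.dpow_sub, hg.dpow_add, hg.dpow_natCast, h1, ← hg.frob, ← Units.val_pow_eq_pow_val,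
        ← Units.val_mul, ← Units.val_mul, div_mul_cancel, mul_comm]
  | of_a r h =>
    cases h with
    | inv_odd hq i i' h =>
      simp only [map_mul, FreeGroup.lift_apply_of, genMap, freeA]
      refine ((ha i').mul_toQ (ha i)).eq_one_of_toQ
        (f := 1 - C (QuadraticAlgebra.norm (dpow δ (i : ZMod (q ^ 2 - 1)) : FZ b c)) * X) ?_
      rw [hg.dpow_add_half hq h, lin_neg_mul_lin]
    | inv_even hq i =>
      simp only [map_mul, FreeGroup.lift_apply_of, genMap, freeA, sq]
      refine ((ha i).mul_toQ (ha i)).eq_one_of_toQ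
        (f := 1 - C (QuadraticAlgebra.norm (dpow δ (i : ZMod (q ^ 2 - 1)) : FZ b c)) * X) ?_
      rw [← lin_mul_lin_neg, hg.neg_eq_self hq]
    | square i j k l hij hk hl =>
      simp only [map_mul, map_inv, FreeGroup.lift_apply_of, genMap, freeA]
      rw [mul_inv_eq_one]
      refine ((ha i).mul_toQ (ha j)).eq_of_toQ ?_
      rw [hg.lin_mul_lin_square hij, ← hk, ← hl]
      exact (ha k).mul_toQ (ha l)

end IsGen

end Homomorphism

/-! ### Words in the generators -/

section Words

variable {𝔽 : Type*} [Field 𝔽] {b c : 𝔽} {q : ℕ} {δ : (FZ b c)ˣ} {M : Set (ZMod (q ^ 2 - 1))}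

/-- The product of the linear skew polynomials along a word. -/
noncomputable def word (δ : (FZ b c)ˣ) (l : List M) : PolyOrder b c :=
  (l.map fun i => lin (dpow δ (i : ZMod (q ^ 2 - 1)) : FZ b c)).prod

/-- The element of the presented group given by a word. -/
def gword (δ : (FZ b c)ˣ) (l : List M) : PGamma M δ :=
  (l.map fun i => (PresentedGroup.of i : PGamma M δ)).prod

theorem word_nil : word δ ([] : List M) = 1 := rfl
theorem gword_nil : gword δ ([] : List M) = 1 := rfl

theorem word_append_singleton (l : List M) (i : M) :
    word δ (l ++ [i]) = word δ l * lin (dpow δ (i : ZMod (q ^ 2 - 1)) : FZ b c) := by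
  simp [word]

theorem gword_append_singleton (l : List M) (i : M) :
    gword δ (l ++ [i]) = gword δ l * PresentedGroup.of i := by
  simp [gword]

theorem gword_cons (l : List M) (i : M) :
    gword δ (i :: l) = PresentedGroup.of i * gword δ l := by
  simp [gword]

theorem evalU_word (l : List M) : evalU 0 (word δ l) = 1 := by
  induction l using List.reverseRecOn with
  | nil => exact evalU_one 0
  | append_singleton l i ih =>
    rw [word_append_singleton, evalU_mul, ih, evalU_lin, map_zero, zero_mul, add_zero, one_mul]

variable [Fact (∀ r : 𝔽, r ^ 2 ≠ c + b * r)]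

/-- If `1 + β F` divides `y (1 + α F)` from the right, then `y` is divisible by `1 + γ F`, where
`(1 + γ F) (1 + α F)` is the least common multiple of `1 + α F` and `1 + β F`. -/
theorem eval_of_eval_mul_lin {α β : FZ b c} (hαβ : α ≠ β) {τ : 𝔽}
    (hτ : QuadraticAlgebra.norm β * τ = 1) {y : PolyOrder b c}
    (h : β * evalU τ (y * lin α) = evalV τ (y * lin α)) :
    star β * (β - α) / star (β - α) * evalU τ y = evalV τ y := by
  have hN : algebraMap 𝔽 (FZ b c) τ * (β * star β) = 1 := by
    rw [← QuadraticAlgebra.algebraMap_norm_eq_mul_star, ← map_mul, mul_comm, hτ, map_one]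
  have hne : star (β - α) ≠ 0 := star_ne_zero.2 (sub_ne_zero.2 hαβ.symm)
  rw [evalU_mul, evalV_mul, evalU_lin, evalV_lin, star_one] at h
  rw [div_mul_eq_mul_div, div_eq_iff hne, star_sub]
  linear_combination star β * h - (evalV τ y * star α) * hN

theorem norm_div_star {x y : FZ b c} (hx : x ≠ 0) :
    QuadraticAlgebra.norm (star y * x / star x) = QuadraticAlgebra.norm y := by
  have h1 : star x ≠ 0 := star_ne_zero.2 hx
  have h2 : QuadraticAlgebra.norm (star x) ≠ 0 :=
    fun h => h1 (QuadraticAlgebra.norm_eq_zero_iff_eq_zero.1 h)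
  refine mul_right_cancel₀ h2 ?_
  rw [← map_mul, div_mul_cancel₀ _ h1, map_mul]
  simp only [QuadraticAlgebra.norm_star]

theorem star_mul_sub_div {α β : FZ b c} (hαβ : α ≠ β)
    (hN : QuadraticAlgebra.norm α = QuadraticAlgebra.norm β) :
    star β * (β - α) / star (β - α) = -α := by
  have hne : star (β - α) ≠ 0 := star_ne_zero.2 (sub_ne_zero.2 hαβ.symm)
  have h := congrArg (algebraMap 𝔽 (FZ b c)) hN
  rw [QuadraticAlgebra.algebraMap_norm_eq_mul_star,
    QuadraticAlgebra.algebraMap_norm_eq_mul_star] at h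
  rw [div_eq_iff hne, star_sub]
  linear_combination -h

namespace IsGen

variable (hg : IsGen q δ)
include hg

/-- This unifies the two inversion relations: -1 is δ^((q²-1)/2) for odd q, and negation is trivial
for even q. -/
theorem of_mul_of_neg {i i' : M} (h : (dpow δ (i' : ZMod (q ^ 2 - 1)) : FZ b c) =
    -(dpow δ (i : ZMod (q ^ 2 - 1)) : FZ b c)) :
    (PresentedGroup.of i' * PresentedGroup.of i : PGamma M δ) = 1 := by
  rcases Nat.even_or_odd q with hq | hq
  · rw [hg.neg_eq_self hq] at h
    rw [Subtype.ext (hg.dpow_val_inj h), ← sq]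
    exact PresentedGroup.one_of_mem (rels := {r | ARel M δ (FreeGroup.of : M → FreeGroup M) r})
      (ARel.inv_even hq i)
  · refine PresentedGroup.one_of_mem (rels := {r | ARel M δ (FreeGroup.of : M → FreeGroup M) r})
      (ARel.inv_odd hq i i' (hg.dpow_val_inj ?_))
    rw [h, hg.dpow_add_half hq rfl]

omit hg [Fact (∀ r : 𝔽, r ^ 2 ≠ c + b * r)] in
theorem of_mul_of_square {i j k l : M} (hij : (i : ZMod (q ^ 2 - 1)) - j ∉ cosetGroup q)
    (hk : (k : ZMod (q ^ 2 - 1)) = kIdx δ i j) (hl : (l : ZMod (q ^ 2 - 1)) = lIdx δ i j) :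
    (PresentedGroup.of i * PresentedGroup.of j : PGamma M δ) =
      PresentedGroup.of k * PresentedGroup.of l :=
  mul_inv_eq_one.1 (PresentedGroup.one_of_mem
    (rels := {r | ARel M δ (FreeGroup.of : M → FreeGroup M) r}) (ARel.square i j k l hij hk hl))

variable (hM : ∀ i ∈ M, ∀ h ∈ cosetGroup q, i + h ∈ M)
include hM

/-- Positive words suffice, because the inverse of a generator is the generator attached to the
negative. -/
theorem exists_gword_eq (g : PGamma M δ) : ∃ l : List M, gword δ l = g := by
  have hinv : ∀ i : M, ∃ i' : M, (PresentedGroup.of i : PGamma M δ)⁻¹ = PresentedGroup.of i' := by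
    intro i
    obtain ⟨i', hi'⟩ := hg.exists_index hM i.2
      (QuadraticAlgebra.norm_neg (dpow δ (i : ZMod (q ^ 2 - 1)) : FZ b c))
    exact ⟨i', inv_eq_of_mul_eq_one_left (hg.of_mul_of_neg hi')⟩
  have hmem : g ∈ Subgroup.closure (Set.range (PresentedGroup.of : M → PGamma M δ)) := by
    rw [PresentedGroup.closure_range_of]; trivial
  induction hmem using Subgroup.closure_induction_left with
  | one => exact ⟨[], rfl⟩
  | mul_left x hx y _ ih =>
    obtain ⟨i, rfl⟩ := hx
    obtain ⟨l, rfl⟩ := ih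
    exact ⟨i :: l, gword_cons l i⟩
  | inv_mul_cancel x hx y _ ih =>
    obtain ⟨i, rfl⟩ := hx
    obtain ⟨l, rfl⟩ := ih
    obtain ⟨i', hi'⟩ := hinv i
    exact ⟨i' :: l, by rw [gword_cons, hi']⟩

/-- If the skew polynomial of a word is divisible by `1 + β F` from the right, then the word can be
rewritten to end with `β`, unless it can be shortened. -/
theorem exists_gword_mul_of (l : List M) : ∀ (j : M) (τ : 𝔽),
    QuadraticAlgebra.norm (dpow δ (j : ZMod (q ^ 2 - 1)) : FZ b c) * τ = 1 →
    (dpow δ (j : ZMod (q ^ 2 - 1)) : FZ b c) * evalU τ (word δ l) = evalV τ (word δ l) →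
    (∃ l' : List M, l'.length + 1 = l.length ∧ gword δ l' * PresentedGroup.of j = gword δ l) ∨
      ∃ l' : List M, l'.length < l.length ∧ gword δ l' = gword δ l := by
  induction l using List.reverseRecOn with
  | nil =>
    intro j τ _ h
    rw [word_nil, evalU_one, evalV_one, mul_one] at h
    exact absurd h (Units.ne_zero _)
  | append_singleton l i ih =>
    intro j τ hτ h
    rw [word_append_singleton] at h
    by_cases hij : i = j
    · subst hij
      exact Or.inl ⟨l, by simp, (gword_append_singleton l i).symm⟩
    have hne : (dpow δ (i : ZMod (q ^ 2 - 1)) : FZ b c) ≠ dpow δ (j : ZMod (q ^ 2 - 1)) :=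
      fun h => hij (Subtype.ext (hg.dpow_val_inj h))
    have hne' := sub_ne_zero.2 hne.symm
    have hdiv := eval_of_eval_mul_lin hne hτ h
    -- Let α, β, γ be the values of i, j, k. The new right divisor 1 + γF of the shorter word has
    -- N(γ) = N(β), so γ is the value of a letter of M at the same τ.
    have hnorm := norm_div_star (y := (dpow δ (j : ZMod (q ^ 2 - 1)) : FZ b c)) hne'
    obtain ⟨k, hk⟩ := hg.exists_index hM j.2 hnorm
    rw [← hk] at hdiv hnorm
    rcases ih k τ (by rw [hnorm, hτ]) hdiv with ⟨l', hl', hgl'⟩ | ⟨l', hl', hgl'⟩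
    · by_cases hN : QuadraticAlgebra.norm (dpow δ (i : ZMod (q ^ 2 - 1)) : FZ b c) =
          QuadraticAlgebra.norm (dpow δ (j : ZMod (q ^ 2 - 1)) : FZ b c)
      -- Equal norms give γ = -α, so the last two letters k, i cancel.
      · rw [star_mul_sub_div hne hN] at hk
        refine Or.inr ⟨l', by simp; omega, ?_⟩
        rw [gword_append_singleton, ← hgl', mul_assoc, hg.of_mul_of_neg hk, mul_one]
      · have hki : (k : ZMod (q ^ 2 - 1)) - i ∉ cosetGroup q := by
          rw [← hg.norm_dpow_eq_iff, hnorm]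
          exact fun h => hN h.symm
        have hl := hg.dpow_lIdx hki
        have hkk := hg.dpow_kIdx hki
        set α : FZ b c := (dpow δ (i : ZMod (q ^ 2 - 1)) : FZ b c)
        set β : FZ b c := (dpow δ (j : ZMod (q ^ 2 - 1)) : FZ b c)
        set γ : FZ b c := (dpow δ (k : ZMod (q ^ 2 - 1)) : FZ b c)
        have hs : star β - star α ≠ 0 := by
          rw [← star_sub]; exact star_ne_zero.2 hne'
        -- (γ + α) times the conjugate of β - α equals N(β) - N(α), which is fixed by conjugation.
        -- Hence γ + α and β - α have the same ratio to their conjugates, and the square relation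
        -- for (k, i) ends in j.
        have hsum : (γ + α) / star (γ + α) = (β - α) / star (β - α) := by
          have h1 : (γ + α) * star (β - α) = β * star β - α * star α := by
            rw [hk, add_mul, div_mul_cancel₀ _ (star_ne_zero.2 hne'), star_sub]
            ring
          have h2 := congrArg star h1
          simp only [star_mul', star_sub, star_star] at h2
          rw [div_eq_div_iff (star_ne_zero.2 (hg.add_ne_zero_of_not_mem hki))
            (star_ne_zero.2 hne'), h1, mul_comm (β - α), h2]
          ring
        have hlj : lIdx δ (k : ZMod (q ^ 2 - 1)) i = j := by
          apply hg.dpow_val_inj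
          rw [hl, hsum, hk, star_div₀, star_mul', star_star, star_star, star_sub]
          field_simp
          rfl
        have hkN : QuadraticAlgebra.norm (dpow δ (kIdx δ (k : ZMod (q ^ 2 - 1)) i) : FZ b c) =
            QuadraticAlgebra.norm α := by
          rw [hkk, div_mul_eq_mul_div, mul_comm]
          exact norm_div_star (hg.add_ne_zero_of_not_mem hki)
        obtain ⟨m, hm⟩ := hg.exists_index hM i.2 hkN
        refine Or.inl ⟨l' ++ [m], by simp; omega, ?_⟩
        rw [gword_append_singleton, gword_append_singleton, ← hgl', mul_assoc, mul_assoc,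
          of_mul_of_square hki (hg.dpow_val_inj hm) hlj.symm]
    · refine Or.inr ⟨l' ++ [i], by simp; omega, ?_⟩
      rw [gword_append_singleton, gword_append_singleton, hgl']

/-- A word of minimal length whose skew polynomial has no `F`-part is empty. -/
theorem eq_nil_of_evalV_eq_zero (l : List M)
    (hmin : ∀ l' : List M, gword δ l' = gword δ l → l.length ≤ l'.length)
    (hV : ∀ τ, evalV τ (word δ l) = 0) : l = [] := by
  induction l using List.reverseRecOn with
  | nil => rfl
  | append_singleton l i _ =>
    exfalso
    obtain ⟨τ, -, hτ⟩ := hg.exists_place i.2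
    set α : FZ b c := (dpow δ (i : ZMod (q ^ 2 - 1)) : FZ b c) with hα
    have hVτ := hV τ
    rw [word_append_singleton] at hVτ
    have hN : algebraMap 𝔽 (FZ b c) τ * (α * star α) = 1 := by
      rw [← QuadraticAlgebra.algebraMap_norm_eq_mul_star, ← map_mul, mul_comm, hτ, map_one]
    -- As N(α)τ = 1, vanishing of the F-coefficient at τ forces the other coefficient to vanish
    -- there too.
    have hUτ : evalU (τ : 𝔽) (word δ l * lin α) = 0 := by
      rw [evalV_mul, evalU_lin, evalV_lin, star_one] at hVτ
      rw [evalU_mul, evalU_lin, evalV_lin]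
      linear_combination (algebraMap 𝔽 (FZ b c) τ * star α) * hVτ - evalU (τ : 𝔽) (word δ l) * hN
    -- A second element of the same norm: shifting the exponent by q - 1 changes it, because 0 < q -
    -- 1 < q² - 1.
    obtain ⟨j, hj, hji⟩ : ∃ j ∈ M, j - i ∈ cosetGroup q ∧ j ≠ i := by
      refine ⟨i + (q - 1), hM i i.2 _ (AddSubgroup.mem_zmultiples _), ?_, ?_⟩
      · rw [add_sub_cancel_left]
        exact AddSubgroup.mem_zmultiples _
      · have h2 := hg.two_le
        rw [Ne, add_eq_left, ← Nat.cast_pred (by omega), ZMod.natCast_eq_zero_iff]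
        intro h
        have := Nat.le_of_dvd (by omega) h
        have : q < q ^ 2 := by nlinarith
        omega
    have hN' : QuadraticAlgebra.norm (dpow δ j : FZ b c) = QuadraticAlgebra.norm α :=
      (hg.norm_dpow_eq_iff j i).2 hji.1
    have hne : α ≠ dpow δ j := fun h => hji.2 (hg.dpow_val_inj h).symm
    have hdiv := eval_of_eval_mul_lin hne (hN'.symm ▸ hτ) (y := word δ l) (by
      rw [hUτ, hVτ, mul_zero])
    rw [star_mul_sub_div hne hN'.symm] at hdiv
    obtain ⟨k, hk⟩ := hg.exists_index hM i.2 (QuadraticAlgebra.norm_neg α)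
    rw [← hk] at hdiv
    rcases hg.exists_gword_mul_of hM l k τ (by rw [hk, QuadraticAlgebra.norm_neg, hτ]) hdiv with
      ⟨l', hl', hgl'⟩ | ⟨l', hl', hgl'⟩
    · have := hmin l' (by
        rw [gword_append_singleton, ← hgl', mul_assoc, hg.of_mul_of_neg hk, mul_one])
      simp at this
      omega
    · have := hmin (l' ++ [i]) (by
        rw [gword_append_singleton, gword_append_singleton, hgl'])
      simp at this
      omega

omit hM in
-- An element of 𝔽 is fixed by Frobenius, so δ^(n(q-1)) = 1 and (q + 1)(q - 1) divides n(q - 1).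
theorem succ_dvd_of_pow_eq_algebraMap {n : ℕ} {r : 𝔽}
    (h : (δ : FZ b c) ^ n = algebraMap 𝔽 (FZ b c) r) : q + 1 ∣ n := by
  have h2 := hg.two_le
  have hfac : q ^ 2 - 1 = (q + 1) * (q - 1) := by simpa using Nat.sq_sub_sq q 1
  have h1 : (δ ^ n) ^ q = δ ^ n := by
    ext1
    rw [Units.val_pow_eq_pow_val, hg.frob, Units.val_pow_eq_pow_val, h]
    ext <;> simp
  have h3 : δ ^ (n * (q - 1)) = 1 := by
    have : n * q = n * (q - 1) + n := by
      obtain ⟨k, rfl⟩ : ∃ k, q = k + 1 := ⟨q - 1, by omega⟩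
      rw [Nat.add_sub_cancel]; ring
    rw [← pow_mul, this, pow_add] at h1
    exact mul_eq_right.1 h1
  rw [← orderOf_dvd_iff_pow_eq_one, hg.order, hfac] at h3
  exact Nat.dvd_of_mul_dvd_mul_right (by omega) h3

end IsGen

end Words

/-! ### The structure of the presented group -/

section Presented

variable {E : Type*} [CommRing E] {q : ℕ} {δ : Eˣ} {M : Set (ZMod (q ^ 2 - 1))}

theorem gammaToLambda_of (i : M) :
    gammaToLambda M δ (PresentedGroup.of i) = PresentedGroup.of (Gen.a i) := by
  simp [gammaToLambda]

theorem mk_eq_one_of_lambdaRel {r : FreeGroup (Gen M)} (h : LambdaRel M δ r) :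
    PresentedGroup.mk {r | LambdaRel M δ r} r = 1 :=
  PresentedGroup.one_of_mem h

theorem of_d_pow : (PresentedGroup.of Gen.d : PLambda M δ) ^ (q + 1) = 1 :=
  mk_eq_one_of_lambdaRel LambdaRel.d_pow

theorem of_s_sq : (PresentedGroup.of Gen.s : PLambda M δ) * PresentedGroup.of Gen.s = 1 := by
  rw [← sq]
  exact mk_eq_one_of_lambdaRel LambdaRel.s_sq

theorem semiconjBy_s_d : SemiconjBy (PresentedGroup.of Gen.s : PLambda M δ)
    (PresentedGroup.of Gen.d) (PresentedGroup.of Gen.d ^ q) := by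
  have h : ((PresentedGroup.of Gen.s : PLambda M δ) * PresentedGroup.of Gen.d) ^ 2 = 1 :=
    mk_eq_one_of_lambdaRel LambdaRel.sd_sq
  have hs := of_s_sq (M := M) (δ := δ)
  have hd := of_d_pow (M := M) (δ := δ)
  rw [pow_succ] at hd
  rw [SemiconjBy, eq_inv_of_mul_eq_one_left hd]
  rw [sq, mul_eq_one_iff_eq_inv, mul_inv_rev, ← eq_inv_of_mul_eq_one_left hs] at h
  exact h

theorem semiconjBy_s_a {i i' : M} (h : (i' : ZMod (q ^ 2 - 1)) = q * i) :
    SemiconjBy (PresentedGroup.of Gen.s : PLambda M δ)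
      (PresentedGroup.of (Gen.a i)) (PresentedGroup.of (Gen.a i')) := by
  have h1 : (PresentedGroup.of Gen.s : PLambda M δ) * PresentedGroup.of (Gen.a i) *
      PresentedGroup.of Gen.s * (PresentedGroup.of (Gen.a i'))⁻¹ = 1 :=
    mk_eq_one_of_lambdaRel (LambdaRel.s_conj i i' h)
  rw [SemiconjBy, ← mul_inv_eq_one.1 h1, mul_assoc _ (PresentedGroup.of Gen.s), of_s_sq, mul_one]

theorem semiconjBy_d_a {i i' : M} (h : (i' : ZMod (q ^ 2 - 1)) = i + 1 - q) :
    SemiconjBy (PresentedGroup.of Gen.d : PLambda M δ)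
      (PresentedGroup.of (Gen.a i)) (PresentedGroup.of (Gen.a i')) := by
  have h1 : (PresentedGroup.of Gen.d : PLambda M δ) * PresentedGroup.of (Gen.a i) *
      (PresentedGroup.of Gen.d)⁻¹ * (PresentedGroup.of (Gen.a i'))⁻¹ = 1 :=
    mk_eq_one_of_lambdaRel (LambdaRel.d_conj i i' h)
  rw [SemiconjBy, ← mul_inv_eq_one.1 h1, inv_mul_cancel_right]

variable (hM : ∀ i ∈ M, ∀ h ∈ cosetGroup q, i + h ∈ M)

/-- An element that permutes the generators a_i into one another by conjugation carries the whole
image of Γ into itself. This lets d and s be moved to the right. -/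
theorem exists_semiconjBy_gammaToLambda {x : PLambda M δ}
    (hx : ∀ i : M, ∃ i' : M, SemiconjBy x (PresentedGroup.of (Gen.a i)) (PresentedGroup.of (Gen.a i')))
    (h : PGamma M δ) : ∃ h', SemiconjBy x (gammaToLambda M δ h) (gammaToLambda M δ h') := by
  have hmem : h ∈ Subgroup.closure (Set.range (PresentedGroup.of : M → PGamma M δ)) := by
    rw [PresentedGroup.closure_range_of]; trivial
  induction hmem using Subgroup.closure_induction with
  | mem y hy =>
    obtain ⟨i, rfl⟩ := hy
    obtain ⟨i', hi'⟩ := hx i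
    exact ⟨PresentedGroup.of i', by rw [gammaToLambda_of, gammaToLambda_of]; exact hi'⟩
  | one => exact ⟨1, by rw [map_one]; exact SemiconjBy.one_right x⟩
  | mul y z _ _ hy hz =>
    obtain ⟨y', hy'⟩ := hy
    obtain ⟨z', hz'⟩ := hz
    exact ⟨y' * z', by rw [map_mul, map_mul]; exact hy'.mul_right hz'⟩
  | inv y _ hy =>
    obtain ⟨y', hy'⟩ := hy
    exact ⟨y'⁻¹, by rw [map_inv, map_inv]; exact hy'.inv_right⟩

include hM in
/-- Every element of `Λ_{M,δ}` is the product of an element of the image of `Γ_{M,δ}` and an element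
of the dihedral group generated by `d` and `s`. -/
theorem exists_eq_mul_dihedral (g : PLambda M δ) : ∃ (h : PGamma M δ) (n : ℕ),
    g = gammaToLambda M δ h * PresentedGroup.of Gen.d ^ n ∨
      g = gammaToLambda M δ h * PresentedGroup.of Gen.d ^ n * PresentedGroup.of Gen.s := by
  have hsa : ∀ i : M, ∃ i' : M, SemiconjBy (PresentedGroup.of Gen.s : PLambda M δ)
      (PresentedGroup.of (Gen.a i)) (PresentedGroup.of (Gen.a i')) := fun i => by
    have : (q : ZMod (q ^ 2 - 1)) * i ∈ M := by
      have h := hM i i.2 ((i : ZMod (q ^ 2 - 1)) * (q - 1)) (by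
        rw [cosetGroup, AddSubgroup.mem_zmultiples_iff]
        obtain ⟨k, hk⟩ := ZMod.intCast_surjective (i : ZMod (q ^ 2 - 1))
        exact ⟨k, by rw [zsmul_eq_mul, hk]⟩)
      convert h using 1
      ring
    exact ⟨⟨_, this⟩, semiconjBy_s_a rfl⟩
  have hda : ∀ i : M, ∃ i' : M, SemiconjBy (PresentedGroup.of Gen.d : PLambda M δ)
      (PresentedGroup.of (Gen.a i)) (PresentedGroup.of (Gen.a i')) := fun i => by
    have : (i : ZMod (q ^ 2 - 1)) + 1 - q ∈ M := by
      have h := hM i i.2 _ ((cosetGroup q).neg_mem (AddSubgroup.mem_zmultiples _))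
      convert h using 1
      ring
    exact ⟨⟨_, this⟩, semiconjBy_d_a rfl⟩
  have hs := of_s_sq (M := M) (δ := δ)
  -- The set of such products is stable under left multiplication by all generators and their
  -- inverses, where d⁻¹ = d^q and s⁻¹ = s.
  let P : PLambda M δ → Prop := fun g => ∃ (h : PGamma M δ) (n : ℕ),
    g = gammaToLambda M δ h * PresentedGroup.of Gen.d ^ n ∨
      g = gammaToLambda M δ h * PresentedGroup.of Gen.d ^ n * PresentedGroup.of Gen.s
  have hPs : ∀ g, P g → P (PresentedGroup.of Gen.s * g) := by
    rintro g ⟨h, n, hg⟩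
    obtain ⟨h', hh'⟩ := exists_semiconjBy_gammaToLambda hsa h
    have hn := hh'.mul_right (semiconjBy_s_d.pow_right n)
    rw [← pow_mul] at hn
    refine ⟨h', q * n, ?_⟩
    rcases hg with rfl | rfl
    · exact Or.inr hn
    · refine Or.inl ?_
      rw [← mul_assoc, hn, mul_assoc _ (PresentedGroup.of Gen.s), hs, mul_one]
  have hPd : ∀ g, P g → P (PresentedGroup.of Gen.d * g) := by
    rintro g ⟨h, n, hg⟩
    obtain ⟨h', hh'⟩ := exists_semiconjBy_gammaToLambda hda h
    refine ⟨h', n + 1, ?_⟩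
    rcases hg with rfl | rfl
    · refine Or.inl ?_
      rw [← mul_assoc, hh'.eq, pow_succ' _ n, mul_assoc]
    · refine Or.inr ?_
      rw [← mul_assoc, ← mul_assoc, hh'.eq, pow_succ' _ n,
        mul_assoc _ (PresentedGroup.of Gen.d)]
  have hPa : ∀ (k : PGamma M δ) (g), P g → P (gammaToLambda M δ k * g) := by
    rintro k g ⟨h, n, hg⟩
    refine ⟨k * h, n, ?_⟩
    rw [map_mul]
    rcases hg with rfl | rfl
    · exact Or.inl (mul_assoc _ _ _).symm
    · exact Or.inr (by simp only [mul_assoc])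
  have hPdn : ∀ (n : ℕ) (g), P g → P (PresentedGroup.of Gen.d ^ n * g) := by
    intro n
    induction n with
    | zero => intro g hg; rwa [pow_zero, one_mul]
    | succ n ih =>
      intro g hg
      rw [pow_succ', mul_assoc]
      exact hPd _ (ih g hg)
  have hmem : g ∈ Subgroup.closure (Set.range (PresentedGroup.of : Gen M → PLambda M δ)) := by
    rw [PresentedGroup.closure_range_of]; trivial
  change P g
  induction hmem using Subgroup.closure_induction_left with
  | one => exact ⟨1, 0, Or.inl (by simp)⟩
  | mul_left x hx y _ ih =>
    obtain ⟨z, rfl⟩ := hx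
    cases z with
    | d => exact hPd y ih
    | s => exact hPs y ih
    | a i => rw [← gammaToLambda_of]; exact hPa _ y ih
  | inv_mul_cancel x hx y _ ih =>
    obtain ⟨z, rfl⟩ := hx
    cases z with
    | d =>
      have hd := of_d_pow (M := M) (δ := δ)
      rw [pow_succ] at hd
      rw [← eq_inv_of_mul_eq_one_left hd]
      exact hPdn q y ih
    | s => rw [← eq_inv_of_mul_eq_one_left hs]; exact hPs y ih
    | a i => rw [← gammaToLambda_of, ← map_inv]; exact hPa _ y ih

end Presented

/-! ### The isomorphism -/

section Isomorphism

variable {𝔽 : Type*} [Field 𝔽] {b c : 𝔽} {q : ℕ} [Fact (∀ r : 𝔽, r ^ 2 ≠ c + b * r)]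
  {δ : (FZ b c)ˣ} {M : Set (ZMod (q ^ 2 - 1))}

namespace IsGen

variable (hg : IsGen q δ)

/-- The homomorphism `Λ_{M,δ} → Λ_S`. -/
noncomputable def toLambda (M : Set (ZMod (q ^ 2 - 1))) : PLambda M δ →* Lambda b c (placesOf M δ) :=
  PresentedGroup.toGroup (f := genMap δ M) hg.lift_genMap_eq_one

theorem toLambda_d : hg.toLambda M (PresentedGroup.of Gen.d) = cls _ (cst (δ : FZ b c)) :=
  PresentedGroup.toGroup.of _

theorem toLambda_s : hg.toLambda M (PresentedGroup.of Gen.s) = cls _ (polyF b c) :=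
  PresentedGroup.toGroup.of _

theorem toLambda_a (i : M) : hg.toLambda M (PresentedGroup.of (Gen.a i)) =
    cls _ (lin (dpow δ (i : ZMod (q ^ 2 - 1)) : FZ b c)) :=
  PresentedGroup.toGroup.of _

theorem isClass_toLambda_gword (l : List M) :
    IsClass (hg.toLambda M (gammaToLambda M δ (gword δ l))) (toQ _ (word δ l)) := by
  induction l using List.reverseRecOn with
  | nil =>
    rw [gword_nil, word_nil, map_one, map_one, map_one]
    exact IsClass.one
  | append_singleton l i ih =>
    rw [gword_append_singleton, word_append_singleton, map_mul, map_mul, gammaToLambda_of,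
      toLambda_a]
    exact ih.mul_toQ (hg.isClass_lin i)

theorem isClass_toLambda_d_pow (n : ℕ) :
    IsClass (hg.toLambda M (PresentedGroup.of Gen.d ^ n)) (toQ _ (cst ((δ : FZ b c) ^ n))) := by
  rw [map_pow, toLambda_d, cst_pow, map_pow]
  exact (isClass_cst δ _).pow n

variable (hM : ∀ i ∈ M, ∀ h ∈ cosetGroup q, i + h ∈ M)
include hM

/-- The core of injectivity: a shortest word for h is empty, after which δⁿ must be a scalar. With n
= 0 it also gives injectivity on Γ. -/
theorem eq_one_of_toLambda_mul_d_pow {h : PGamma M δ} {n : ℕ}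
    (hh : hg.toLambda M (gammaToLambda M δ h * PresentedGroup.of Gen.d ^ n) = 1) :
    h = 1 ∧ (PresentedGroup.of Gen.d : PLambda M δ) ^ n = 1 := by
  obtain ⟨l, hl, hmin⟩ : ∃ l : List M, gword δ l = h ∧
      ∀ l' : List M, gword δ l' = h → l.length ≤ l'.length := by
    have hne : {l : List M | gword δ l = h}.Nonempty := hg.exists_gword_eq hM h
    obtain ⟨l, hl, hl'⟩ := WellFounded.has_min (measure (List.length (α := M))).wf _ hne
    exact ⟨l, hl, fun l' h' => not_lt.1 (hl' l' h')⟩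
  have hc := (hg.isClass_toLambda_gword l).mul_toQ (hg.isClass_toLambda_d_pow (M := M) n)
  rw [← map_mul, hl, hh] at hc
  obtain ⟨f, hf⟩ := exists_eq_algebraMap_of_isClass hc
  have hδ : (δ : FZ b c) ^ n ≠ 0 := pow_ne_zero _ δ.ne_zero
  -- A central element has no F-part, and right multiplication by the constant δⁿ only scales the
  -- F-part by an invertible factor.
  have hV : ∀ τ, evalV τ (word δ l) = 0 := by
    intro τ
    have := evalV_algebraMap (b := b) (c := c) τ f
    rw [← hf, evalV_mul, evalU_cst, evalV_cst, mul_zero, zero_add] at this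
    exact (mul_eq_zero.1 this).resolve_right (star_ne_zero.2 hδ)
  have hnil := hg.eq_nil_of_evalV_eq_zero hM l (fun l' h' => hmin l' (h'.trans hl)) hV
  subst hnil
  refine ⟨hl.symm.trans gword_nil, ?_⟩
  rw [word_nil, one_mul] at hf
  have hU := congrArg (evalU 0) hf
  rw [evalU_cst, evalU_algebraMap] at hU
  obtain ⟨k, rfl⟩ := hg.succ_dvd_of_pow_eq_algebraMap hU
  rw [pow_mul, of_d_pow, one_pow]

/-- At t = 0 a product of factors 1 + αF has first coefficient 1. After multiplying by δⁿF the
F-coefficient there is δⁿ ≠ 0, which no central element allows. -/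
theorem toLambda_mul_d_pow_mul_s_ne_one (h : PGamma M δ) (n : ℕ) :
    hg.toLambda M (gammaToLambda M δ h * PresentedGroup.of Gen.d ^ n * PresentedGroup.of Gen.s) ≠
      1 := by
  intro hh
  obtain ⟨l, rfl⟩ := hg.exists_gword_eq hM h
  have hs := isClass_polyF (b := b) (c := c) (placesOf M δ)
  rw [← toLambda_s hg] at hs
  have hc := ((hg.isClass_toLambda_gword l).mul_toQ
    (hg.isClass_toLambda_d_pow (M := M) n)).mul_toQ hs
  rw [← map_mul, ← map_mul, hh] at hc
  obtain ⟨f, hf⟩ := exists_eq_algebraMap_of_isClass hc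
  have hV := congrArg (evalV 0) hf
  rw [evalV_algebraMap, evalV_mul, evalU_polyF, evalV_polyF, star_zero, mul_zero, add_zero, mul_one,
    evalU_mul, evalU_word, evalU_cst, map_zero, zero_mul, add_zero, one_mul] at hV
  exact pow_ne_zero _ δ.ne_zero hV

theorem toLambda_injective : Function.Injective (hg.toLambda M) := by
  rw [injective_iff_map_eq_one]
  intro g hgo
  obtain ⟨h, n, rfl | rfl⟩ := exists_eq_mul_dihedral hM g
  · obtain ⟨rfl, h2⟩ := hg.eq_one_of_toLambda_mul_d_pow hM hgo
    rw [map_one, one_mul, h2]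
  · exact absurd hgo (hg.toLambda_mul_d_pow_mul_s_ne_one hM h n)

theorem toLambda_comp_gammaToLambda_injective :
    Function.Injective ((hg.toLambda M).comp (gammaToLambda M δ)) := by
  rw [injective_iff_map_eq_one]
  intro h hh
  refine (hg.eq_one_of_toLambda_mul_d_pow hM (n := 0) ?_).1
  rwa [pow_zero, mul_one]

theorem toLambda_surjective : Function.Surjective (hg.toLambda M) := by
  rw [← MonoidHom.range_eq_top]
  refine eq_top_of_isClass_mem ?_ ?_ ?_ ?_
  · intro α g hα hgα
    obtain ⟨i, rfl⟩ := hg.exists_dpow_eq hα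
    obtain ⟨n, rfl⟩ := hg.exists_natCast i
    refine ⟨PresentedGroup.of Gen.d ^ n, ?_⟩
    rw [hg.dpow_natCast, Units.val_pow_eq_pow_val] at hgα
    exact (hg.isClass_toLambda_d_pow n).eq_of_toQ hgα
  · intro g hgF
    exact ⟨PresentedGroup.of Gen.s, (toLambda_s hg).trans ((isClass_polyF _).eq_of_toQ hgF)⟩
  · intro τ hτ α g hα hgα
    obtain ⟨i, rfl⟩ := hg.exists_index_of_place hM hτ hα
    exact ⟨PresentedGroup.of (Gen.a i), (toLambda_a hg i).trans ((hg.isClass_lin i).eq_of_toQ hgα)⟩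
  · intro τ hτ
    obtain ⟨i, -, hi⟩ := hg.norm_mul_of_mem_placesOf hτ
    exact ⟨_, hi⟩

theorem range_toLambda_comp_gammaToLambda :
    ((hg.toLambda M).comp (gammaToLambda M δ)).range = Gamma b c (placesOf M δ) := by
  apply le_antisymm
  · rintro _ ⟨h, rfl⟩
    have hmem : h ∈ Subgroup.closure (Set.range (PresentedGroup.of : M → PGamma M δ)) := by
      rw [PresentedGroup.closure_range_of]; trivial
    induction hmem using Subgroup.closure_induction with
    | mem y hy =>
      obtain ⟨i, rfl⟩ := hy
      obtain ⟨τ, hτ, hn⟩ := hg.exists_place i.2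
      refine Subgroup.subset_closure ⟨dpow δ (i : ZMod (q ^ 2 - 1)), ⟨τ, hτ, ?_⟩, ?_⟩
      · rw [Units.val_inv_eq_inv_val]
        exact eq_inv_of_mul_eq_one_left hn
      · rw [MonoidHom.comp_apply, gammaToLambda_of, toLambda_a, ← toQ_lin]
        exact hg.isClass_lin i
    | one => rw [map_one]; exact Subgroup.one_mem _
    | mul y z _ _ hy hz => rw [map_mul]; exact Subgroup.mul_mem _ hy hz
    | inv y _ hy => rw [map_inv]; exact Subgroup.inv_mem _ hy
  · rw [Gamma, Subgroup.closure_le]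
    rintro g ⟨α, ⟨τ, hτ, hn⟩, hgα⟩
    rw [← toQ_lin] at hgα
    have hα : QuadraticAlgebra.norm α * (τ : 𝔽) = 1 := by rw [hn, Units.inv_mul]
    obtain ⟨i, rfl⟩ := hg.exists_index_of_place hM hτ hα
    refine ⟨PresentedGroup.of i, ?_⟩
    rw [MonoidHom.comp_apply, gammaToLambda_of, toLambda_a]
    exact (hg.isClass_lin i).eq_of_toQ hgα

end IsGen

end Isomorphism

end QuatLattice

open QuatLattice
theorem proposition2p19 {𝔽 : Type*} [Field 𝔽] [Fintype 𝔽] (q : ℕ) (hq : Fintype.card 𝔽 = q)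
    (b c : 𝔽) (hbc : IsParam q b c)
    (δ : (FZ b c)ˣ) (hδ : ∀ x : (FZ b c)ˣ, x ∈ Subgroup.zpowers δ)
    (M : Set (ZMod (q ^ 2 - 1))) (hM : ∀ i ∈ M, ∀ h ∈ cosetGroup q, i + h ∈ M) :
    ∃ φ : PLambda M δ ≃* Lambda b c (placesOf M δ),
      IsClass (φ (PresentedGroup.of Gen.d)) (emb (placesOf M δ) (δ : FZ b c)) ∧
      IsClass (φ (PresentedGroup.of Gen.s)) (elemF b c (placesOf M δ)) ∧
      (∀ i : M, IsClass (φ (PresentedGroup.of (Gen.a i)))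
        (1 + emb (placesOf M δ) (dpow δ (i : ZMod (q ^ 2 - 1)) : FZ b c) *
          elemF b c (placesOf M δ))) ∧
      ∃ ψ : PGamma M δ ≃* Gamma b c (placesOf M δ),
        ∀ g : PGamma M δ, (ψ g : Lambda b c (placesOf M δ)) = φ (gammaToLambda M δ g) := by
  have := hbc.no_root hq
  have hg := isGen_of_card hq δ hδ
  refine ⟨MulEquiv.ofBijective (hg.toLambda M)
    ⟨hg.toLambda_injective hM, hg.toLambda_surjective hM⟩, ?_, ?_, fun i => ?_,
    (MonoidHom.ofInjective (hg.toLambda_comp_gammaToLambda_injective hM)).trans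
      (MulEquiv.subgroupCongr (hg.range_toLambda_comp_gammaToLambda hM)), fun g => rfl⟩
  · change IsClass (hg.toLambda M (PresentedGroup.of Gen.d)) _
    rw [hg.toLambda_d, ← toQ_cst]
    exact isClass_cst δ _
  · change IsClass (hg.toLambda M (PresentedGroup.of Gen.s)) _
    rw [hg.toLambda_s, ← toQ_polyF]
    exact isClass_polyF _
  · change IsClass (hg.toLambda M (PresentedGroup.of (Gen.a i))) _
    rw [hg.toLambda_a, ← toQ_lin]
    exact hg.isClass_lin i
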